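/- Let $d,m\ge 1$ be integers with $d=1$ or $m=1$. Let $\Gamma\subset\mathbb{R}^d$ be the lattice generated by a basis $\gamma_1,\dots,\gamma_d$ of $\mathbb{R}^d$, let $\Gamma^*=\{k: k\cdot\gamma\in 2\pi\mathbb{Z}\ \forall\gamma\in\Gamma\}$, let $\mathbb{T}^*_d=\mathbb{R}^d/\Gamma^*$ with Lebesgue measure (integrals over $\mathbb{T}^*_d$ are integrals over the centered fundamental cell $Y^*$ of $\Gamma^*$), let $\mathcal{H}_{\mathrm f}=L^2(\mathbb{R}^d/\Gamma;\mathbb{C})$, and let $(\tau(\lambda)f)(y)=e^{i\lambda\cdot y}f(y)$ for $\lambda\in\Gamma^*$, $f\in\mathcal{H}_{\mathrm f}$. Let $k\mapsto P(k)$ be a smooth map from $\mathbb{R}^d$ to the orthogonal projectors of rank $m$ in $\mathcal{H}_{\mathrm f}$ with $P(k+\lambda)=\tau(\lambda)^{-1}P(k)\tau(\lambda)$ for all $k\in\mathbb{R}^d$, $\lambda\in\Gamma^*$. Let $\chi=(\chi_1,\dots,\chi_m)$ be a real-analytic Bloch frame for $P$: the functions $\chi_a:\mathbb{R}^d\to\mathcal{H}_{\mathrm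 f}$ are real-analytic, satisfy, for every $\lambda\in\Gamma^*$, $\chi_a(k-\lambda)=\tau(\lambda)\chi_a(k)$ for a.e. $k$, satisfy $P(k)\chi_a(k)=\chi_a(k)\neq 0$ for all $k\in Y^*$, and $(\chi_1(k),\dots,\chi_m(k))$ is an orthonormal basis of $\operatorname{Ran}P(k)$ for a.e. $k\in Y^*$. Let $A_j$, $1\le j\le d$, be the matrices of the Berry connection, $[A_j(k)]_{cb}=\langle\chi_c(k),\partial_{k_j}\chi_b(k)\rangle_{\mathcal{H}_{\mathrm f}}$. Let $U\in W^{1,2}(\mathbb{T}^*_d;\mathcal{U}(m))$, that is, $U$ is a $\Gamma^*$-periodic function with values in $M_m(\mathbb{C})$, unitary almost everywhere, that has weak partial derivatives $\partial_jU=\partial U/\partial k_j$ in $L^2(\mathbb{T}^*_d;M_m(\mathbb{C}))$. Put $G^j=\operatorname{diag}\Big(\int_{\mathbb{T}^*_d}U^*\,(\partial_jU+A_jU)\,dk\Big)$, where $[\operatorname{diag}M]_{ab}=M_{aa}\delta_{ab}$, and let $s\in\{1,-1\}$. Suppose that $U$ is a weak solution of $$-\Delta U+\sum_{j=1}^d \partial_jU\,U^{-1}\partial_jU+\sum_{j=1}^d\Big[\partial_jU\,U^{-1}A_jU-(\partial_jA_j)U-A_j\,\partial_jU\Big]+s\sum_{j=1}^d\Big[-(\partial_jU+A_jU)G^j+U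 G^jU^{-1}(\partial_jU+A_jU)\Big]=0,$$ that is, for every $\varphi\in C^\infty(\mathbb{T}^*_d;M_m(\mathbb{C}))$, $$\sum_{j=1}^d\int_{\mathbb{T}^*_d}\operatorname{tr}\Big[(\partial_j\varphi)^*\partial_jU+\varphi^*\Big(\partial_jU\,U^{-1}\partial_jU+\partial_jU\,U^{-1}A_jU-(\partial_jA_j)U-A_j\,\partial_jU+s\big(-(\partial_jU+A_jU)G^j+UG^jU^{-1}(\partial_jU+A_jU)\big)\Big)\Big]dk=0 .$$ Then $U$ is real-analytic: it coincides almost everywhere with a $\Gamma^*$-periodic real-analytic map $V:\mathbb{R}^d\to M_m(\mathbb{C})$ with $V(k)\in\mathcal{U}(m)$ for every $k$. -/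

import Mathlib

open MeasureTheory Set
open scoped Matrix ContDiff InnerProductSpace

namespace BlochGauge

noncomputable section

/-- Euclidean space `ℝ^d`, used both for positions and for (quasi-)momenta. -/
abbrev Space (d : ℕ) := EuclideanSpace ℝ (Fin d)

/-- The lattice `Γ` generated over `ℤ` by the basis `γ`. -/
def lattice {d : ℕ} (γ : Module.Basis (Fin d) ℝ (Space d)) : AddSubgroup (Space d) :=
  AddSubgroup.closure (Set.range γ)

/-- The dual lattice `Γ* = {k : k · g ∈ 2πℤ for all g ∈ Γ}`. -/
def dualLattice {d : ℕ} (γ : Module.Basis (Fin d) ℝ (Space d)) : AddSubgroup (Space d) where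
  carrier := {k | ∀ g ∈ lattice γ, ∃ n : ℤ, ⟪k, g⟫_ℝ = 2 * Real.pi * n}
  zero_mem' := fun _ _ => ⟨0, by simp⟩
  add_mem' := by
    intro x y hx hy g hg
    obtain ⟨n, hn⟩ := hx g hg
    obtain ⟨p, hp⟩ := hy g hg
    exact ⟨n + p, by rw [inner_add_left, hn, hp]; push_cast; ring⟩
  neg_mem' := by
    intro x hx g hg
    obtain ⟨n, hn⟩ := hx g hg
    exact ⟨-n, by rw [inner_neg_left, hn]; push_cast; ring⟩

/-- The centered fundamental domain `Y` of `Γ`. -/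
def cell {d : ℕ} (γ : Module.Basis (Fin d) ℝ (Space d)) : Set (Space d) :=
  {x | ∀ j, γ.repr x j ∈ Set.Icc (-(1 / 2) : ℝ) (1 / 2)}

/-- The centered fundamental domain `Y*` of `Γ*`. The coordinate of `k` along the dual basis
vector `γ*_j` (where `γ*_j · γ_i = 2π δ_{ij}`) is `k · γ_j / 2π`. -/
def dualCell {d : ℕ} (γ : Module.Basis (Fin d) ℝ (Space d)) : Set (Space d) :=
  {k | ∀ j, ⟪k, γ j⟫_ℝ / (2 * Real.pi) ∈ Set.Icc (-(1 / 2) : ℝ) (1 / 2)}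

/-- The torus `ℝ^d / Γ`. -/
abbrev Torus {d : ℕ} (γ : Module.Basis (Fin d) ℝ (Space d)) := Space d ⧸ lattice γ

/-- The flat (Lebesgue) measure of `ℝ^d / Γ`. -/
def torusMeasure {d : ℕ} (γ : Module.Basis (Fin d) ℝ (Space d)) : Measure (Torus γ) :=
  (volume.restrict (cell γ)).map (QuotientAddGroup.mk : Space d → Torus γ)

/-- The fibre Hilbert space `L²(ℝ^d / Γ; ℂ)`. -/
abbrev Fiber {d : ℕ} (γ : Module.Basis (Fin d) ℝ (Space d)) := Lp ℂ 2 (torusMeasure γ)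

/-- The function `y ↦ e^{i l·y}` on `ℝ^d / Γ`, for `l ∈ Γ*`. -/
def phase {d : ℕ} (γ : Module.Basis (Fin d) ℝ (Space d)) (l : dualLattice γ) : Torus γ → ℂ :=
  Quotient.lift (fun y : Space d => Complex.exp (Complex.I * (⟪(l : Space d), y⟫_ℝ : ℂ))) (by
    intro x y hxy
    have h : -x + y ∈ lattice γ := QuotientAddGroup.leftRel_apply.mp hxy
    obtain ⟨n, hn⟩ := l.2 _ h
    have hy : ⟪(l : Space d), y⟫_ℝ = ⟪(l : Space d), x⟫_ℝ + 2 * Real.pi * n := by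
      rw [← hn, ← inner_add_right]; simp
    simp only [hy]
    rw [Complex.exp_eq_exp_iff_exists_int]
    exact ⟨-n, by push_cast; ring⟩)

theorem phase_mk {d : ℕ} (γ : Module.Basis (Fin d) ℝ (Space d)) (l : dualLattice γ)
    (y : Space d) :
    phase γ l (QuotientAddGroup.mk y) = Complex.exp (Complex.I * (⟪(l : Space d), y⟫_ℝ : ℂ)) :=
  rfl

theorem norm_phase {d : ℕ} (γ : Module.Basis (Fin d) ℝ (Space d)) (l : dualLattice γ)
    (y : Torus γ) : ‖phase γ l y‖ = 1 := by
  induction y using QuotientAddGroup.induction_on with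
  | H y => rw [phase_mk, mul_comm]; exact Complex.norm_exp_ofReal_mul_I _

theorem phase_neg_mul {d : ℕ} (γ : Module.Basis (Fin d) ℝ (Space d)) (l : dualLattice γ)
    (y : Torus γ) : phase γ (-l) y * phase γ l y = 1 := by
  induction y using QuotientAddGroup.induction_on with
  | H y =>
    rw [phase_mk, phase_mk, ← Complex.exp_add]
    simp

theorem measurable_phase {d : ℕ} (γ : Module.Basis (Fin d) ℝ (Space d)) (l : dualLattice γ) :
    Measurable (phase γ l) := by
  refine measurable_from_quotient.mpr ?_
  change Measurable fun y : Space d => Complex.exp (Complex.I * (⟪(l : Space d), y⟫_ℝ : ℂ))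
  fun_prop

theorem memLp_phase_mul {d : ℕ} (γ : Module.Basis (Fin d) ℝ (Space d)) (l : dualLattice γ)
    (f : Fiber γ) : MemLp (fun y => phase γ l y * f y) 2 (torusMeasure γ) := by
  refine (Lp.memLp f).of_le
    ((measurable_phase γ l).aestronglyMeasurable.mul (Lp.aestronglyMeasurable f)) ?_
  exact Filter.Eventually.of_forall fun y => by rw [norm_mul, norm_phase, one_mul]

/-- Multiplication by `e^{i l·y}` as a linear map of the fibre space. -/
def tauLin {d : ℕ} (γ : Module.Basis (Fin d) ℝ (Space d)) (l : dualLattice γ) :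
    Fiber γ →ₗ[ℂ] Fiber γ where
  toFun f := (memLp_phase_mul γ l f).toLp _
  map_add' f g := by
    apply Lp.ext
    filter_upwards [(memLp_phase_mul γ l (f + g)).coeFn_toLp, (memLp_phase_mul γ l f).coeFn_toLp,
      (memLp_phase_mul γ l g).coeFn_toLp, Lp.coeFn_add f g,
      Lp.coeFn_add ((memLp_phase_mul γ l f).toLp _) ((memLp_phase_mul γ l g).toLp _)]
      with y h1 h2 h3 h4 h5
    rw [h1, h5, Pi.add_apply, h2, h3, h4, Pi.add_apply, mul_add]
  map_smul' c f := by
    apply Lp.ext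
    filter_upwards [(memLp_phase_mul γ l (c • f)).coeFn_toLp, (memLp_phase_mul γ l f).coeFn_toLp,
      Lp.coeFn_smul c f, Lp.coeFn_smul c ((memLp_phase_mul γ l f).toLp _)] with y h1 h2 h3 h4
    simp only [RingHom.id_apply]
    rw [h1, h4, Pi.smul_apply, h2, h3, Pi.smul_apply, smul_eq_mul, smul_eq_mul]
    ring

theorem tauLin_neg_tauLin {d : ℕ} (γ : Module.Basis (Fin d) ℝ (Space d)) (l : dualLattice γ)
    (f : Fiber γ) : tauLin γ (-l) (tauLin γ l f) = f := by
  apply Lp.ext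
  filter_upwards [(memLp_phase_mul γ (-l) (tauLin γ l f)).coeFn_toLp,
    (memLp_phase_mul γ l f).coeFn_toLp] with y h1 h2
  refine h1.trans ?_
  have h2' : (tauLin γ l f : Torus γ → ℂ) y = phase γ l y * f y := h2
  rw [h2', ← mul_assoc, phase_neg_mul, one_mul]

/-- The unitary representation `τ` of `Γ*` on the fibre space,
`(τ(l) f)(y) = e^{i l·y} f(y)`. -/
def tau {d : ℕ} (γ : Module.Basis (Fin d) ℝ (Space d)) (l : dualLattice γ) :
    Fiber γ ≃ₗᵢ[ℂ] Fiber γ where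
  toLinearEquiv := LinearEquiv.ofLinearMap (tauLin γ l) (tauLin γ (-l))
    (by ext1 f; simpa using tauLin_neg_tauLin γ (-l) f)
    (by ext1 f; exact tauLin_neg_tauLin γ l f)
  norm_map' f := by
    change ‖(memLp_phase_mul γ l f).toLp _‖ = ‖f‖
    rw [Lp.norm_toLp, Lp.norm_def]
    congr 1
    exact eLpNorm_congr_norm_ae (Filter.Eventually.of_forall fun y => by
      rw [norm_mul, norm_phase, one_mul])

/-- A smooth, `τ`-covariant family of rank-`m` orthogonal projectors on the fibre space. -/
structure IsProjectorFamily {d : ℕ} (γ : Module.Basis (Fin d) ℝ (Space d)) (m : ℕ)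
    (P : Space d → Fiber γ →L[ℂ] Fiber γ) : Prop where
  isStarProjection : ∀ k, IsStarProjection (P k)
  rank_range : ∀ k, Module.rank ℂ (P k).range = m
  smooth : ContDiff ℝ ∞ P
  covariant : ∀ (k : Space d) (l : dualLattice γ) (f : Fiber γ),
    P (k + l) f = (tau γ l).symm (P k (tau γ l f))

/-- The space `H_τ` of locally square-integrable `τ`-equivariant functions. -/
structure MemHTau {d : ℕ} (γ : Module.Basis (Fin d) ℝ (Space d))
    (f : Space d → Fiber γ) : Prop where
  locallyL2 : ∀ K : Set (Space d), IsCompact K → MemLp f 2 (volume.restrict K)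
  equivariant : ∀ l : dualLattice γ, ∀ᵐ k : Space d, f (k - l) = tau γ l (f k)

/-- A quasi-Bloch function for the family `P`. -/
structure IsQuasiBloch {d : ℕ} (γ : Module.Basis (Fin d) ℝ (Space d))
    (P : Space d → Fiber γ →L[ℂ] Fiber γ) (f : Space d → Fiber γ) : Prop where
  memHTau : MemHTau γ f
  proj_eq : ∀ k ∈ dualCell γ, P k (f k) = f k
  ne_zero : ∀ k ∈ dualCell γ, f k ≠ 0

/-- A Bloch frame for the family `P`. -/
structure IsBlochFrame {d m : ℕ} (γ : Module.Basis (Fin d) ℝ (Space d))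
    (P : Space d → Fiber γ →L[ℂ] Fiber γ) (χ : Fin m → Space d → Fiber γ) : Prop where
  quasiBloch : ∀ a, IsQuasiBloch γ P (χ a)
  orthonormal : ∀ᵐ k ∂(volume.restrict (dualCell γ)), Orthonormal ℂ fun a => χ a k
  span_eq : ∀ᵐ k ∂(volume.restrict (dualCell γ)),
    Submodule.span ℂ (Set.range fun a => χ a k) = (P k).range

/-- The classical partial derivative `∂F/∂k_j` of a vector-valued function. -/
def partialDeriv {d : ℕ} {F : Type*} [NormedAddCommGroup F] [NormedSpace ℝ F] (j : Fin d)
    (f : Space d → F) (k : Space d) : F :=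
  fderiv ℝ f k (EuclideanSpace.single j 1)

/-- The entrywise classical partial derivative of a matrix-valued function. -/
def matPartialDeriv {d m : ℕ} (j : Fin d) (f : Space d → Matrix (Fin m) (Fin m) ℂ)
    (k : Space d) : Matrix (Fin m) (Fin m) ℂ :=
  Matrix.of fun a b => partialDeriv j (fun q => f q a b) k

/-- The Berry connection, `[A_j(k)]_{cb} = ⟨χ_c(k), ∂χ_b/∂k_j (k)⟩`. -/
def berry {d m : ℕ} {γ : Module.Basis (Fin d) ℝ (Space d)} (χ : Fin m → Space d → Fiber γ)
    (j : Fin d) (k : Space d) : Matrix (Fin m) (Fin m) ℂ :=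
  Matrix.of fun c b => ⟪χ c k, partialDeriv j (χ b) k⟫_ℂ

/-- `Γ*`-periodicity: such functions are the functions on the torus `ℝ^d / Γ*`. -/
def IsPeriodic {d : ℕ} {F : Type*} (γ : Module.Basis (Fin d) ℝ (Space d))
    (f : Space d → F) : Prop :=
  ∀ k, ∀ l ∈ dualLattice γ, f (k + l) = f k

/-- Matrix-valued smooth functions on the torus `ℝ^d / Γ*`. -/
structure IsTestFunction {d m : ℕ} (γ : Module.Basis (Fin d) ℝ (Space d))
    (φ : Space d → Matrix (Fin m) (Fin m) ℂ) : Prop where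
  periodic : IsPeriodic γ φ
  smooth : ∀ a b, ContDiff ℝ ∞ fun k => φ k a b

/-- Matrix-valued square-integrable functions on the torus `ℝ^d / Γ*`. -/
structure MemL2 {d m : ℕ} (γ : Module.Basis (Fin d) ℝ (Space d))
    (f : Space d → Matrix (Fin m) (Fin m) ℂ) : Prop where
  periodic : IsPeriodic γ f
  memLp : ∀ a b, MemLp (fun k => f k a b) 2 (volume.restrict (dualCell γ))

/-- `DU j`, for `j = 1, …, d`, are square-integrable functions on the torus which are the weak
partial derivatives of `U`: `∫ tr((∂_j φ)* U) = - ∫ tr(φ* DU_j)` for all smooth `φ`. -/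
structure IsWeakGradient {d m : ℕ} (γ : Module.Basis (Fin d) ℝ (Space d))
    (U : Space d → Matrix (Fin m) (Fin m) ℂ)
    (DU : Fin d → Space d → Matrix (Fin m) (Fin m) ℂ) : Prop where
  memL2 : ∀ j, MemL2 γ (DU j)
  integral_eq : ∀ j, ∀ φ : Space d → Matrix (Fin m) (Fin m) ℂ, IsTestFunction γ φ →
    ∫ k in dualCell γ, ((matPartialDeriv j φ k)ᴴ * U k).trace
      = -∫ k in dualCell γ, ((φ k)ᴴ * DU j k).trace

/-- The Sobolev space `W^{1,2}(ℝ^d / Γ*; U(m))`. -/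
structure MemW12Unitary {d m : ℕ} (γ : Module.Basis (Fin d) ℝ (Space d))
    (U : Space d → Matrix (Fin m) (Fin m) ℂ) : Prop where
  memL2 : MemL2 γ U
  unitary : ∀ᵐ k : Space d, U k ∈ Matrix.unitaryGroup (Fin m) ℂ
  weakGradient : ∃ DU, IsWeakGradient γ U DU

/-- The constant diagonal matrices `G^j = diag (∫ U* (∂_j U + A_j U) dk)`. -/
def diagMean {d m : ℕ} (γ : Module.Basis (Fin d) ℝ (Space d))
    (A : Fin d → Space d → Matrix (Fin m) (Fin m) ℂ) (U : Space d → Matrix (Fin m) (Fin m) ℂ)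
    (DU : Fin d → Space d → Matrix (Fin m) (Fin m) ℂ) (j : Fin d) : Matrix (Fin m) (Fin m) ℂ :=
  Matrix.diagonal fun a => ∫ k in dualCell γ, ((U k)ᴴ * (DU j k + A j k * U k)) a a

/-- The `j`-th summand of the lower order part of the Euler-Lagrange equation. The factor `s`
in front of the terms with `G^j` is a sign. -/
def lowerOrder {d m : ℕ} (γ : Module.Basis (Fin d) ℝ (Space d)) (s : ℝ)
    (A : Fin d → Space d → Matrix (Fin m) (Fin m) ℂ) (U : Space d → Matrix (Fin m) (Fin m) ℂ)
    (DU : Fin d → Space d → Matrix (Fin m) (Fin m) ℂ) (j : Fin d) (k : Space d) :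
    Matrix (Fin m) (Fin m) ℂ :=
  DU j k * (U k)⁻¹ * DU j k
    + (DU j k * (U k)⁻¹ * A j k * U k - matPartialDeriv j (A j) k * U k - A j k * DU j k)
    + s • (-((DU j k + A j k * U k) * diagMean γ A U DU j)
      + U k * diagMean γ A U DU j * (U k)⁻¹ * (DU j k + A j k * U k))

/-- `U` is a weak solution on the torus `ℝ^d / Γ*` of
`-ΔU + ∑_j ∂_jU U⁻¹ ∂_jU + ∑_j [∂_jU U⁻¹ A_j U - (∂_jA_j) U - A_j ∂_jU]
  + s ∑_j [-(∂_jU + A_j U) G^j + U G^j U⁻¹ (∂_jU + A_j U)] = 0`. -/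
def IsWeakSolution {d m : ℕ} (γ : Module.Basis (Fin d) ℝ (Space d)) (s : ℝ)
    (A : Fin d → Space d → Matrix (Fin m) (Fin m) ℂ)
    (U : Space d → Matrix (Fin m) (Fin m) ℂ) : Prop :=
  ∃ DU, IsWeakGradient γ U DU ∧
    ∀ φ : Space d → Matrix (Fin m) (Fin m) ℂ, IsTestFunction γ φ →
      ∑ j, ∫ k in dualCell γ,
        ((matPartialDeriv j φ k)ᴴ * DU j k + (φ k)ᴴ * lowerOrder γ s A U DU j k).trace = 0

/-- `U`, as a class of functions modulo null sets, is a real-analytic map from the torus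
`ℝ^d / Γ*` to `U(m)`. -/
def IsRealAnalytic {d m : ℕ} (γ : Module.Basis (Fin d) ℝ (Space d))
    (U : Space d → Matrix (Fin m) (Fin m) ℂ) : Prop :=
  ∃ V : Space d → Matrix (Fin m) (Fin m) ℂ,
    IsPeriodic γ V ∧ (∀ k, V k ∈ Matrix.unitaryGroup (Fin m) ℂ) ∧
    (∀ a b, AnalyticOnNhd ℝ (fun k => V k a b) Set.univ) ∧ U =ᵐ[volume] V

end

end BlochGauge

namespace BlochGauge

noncomputable section

open Filter Topology UnitAddTorus
open scoped ComplexConjugate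

-- Put `B_j = U* (∂_jU + A_j U)`. Because `U* U = 1` forces `∂_jU* = -U* ∂_jU U*`, multiplying the
-- equation by `U*` cancels every term quadratic in `∂U` and every term containing `A`. What remains
-- is a linear first-order identity, `∑_j ∂_j B_j = s ∑_j [G^j, B_j]`, with constant diagonal `G^j`
-- (`lowerTerm_identity`, `coeff_div_gauge`).
--
-- In either case of the hypothesis this makes the Fourier coefficients of `B_j` decay
-- exponentially. If `d = 1`, the identity reads `(θ(n) - s (g_a - g_b)) B_ab(n) = 0` with `θ`
-- injective, so each entry has at most one nonzero coefficient (`expDecay_of_symbol_mul_eq`). If `m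
-- = 1`, the commutator vanishes and `B_j = U* ∂_jU + A_j`. The field `U* ∂_jU` is curl-free and its
-- divergence is minus that of the analytic field `A`. Solving the div-curl system frequency by
-- frequency bounds it by the coefficients of `A` (`expDecay_of_curl_div`).
--
-- Finally `∂_jU = U B_j - A_j U` is a linear system for `U` whose coefficients are analytic in the
-- Fourier sense. A weighted-supremum argument for the resulting convolution inequality gives
-- exponential decay for `U` (`exp_decay_of_conv_le`, `expDecay_of_deriv`), and the Fourier series
-- of `U` is the analytic representative.
--
-- All derivatives are Fourier multipliers, so no regularity beyond `W^{1,2}` is presupposed. The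
-- delicate point is multiplying an equation whose right side is merely integrable by the bounded
-- function `U*`; `coeff_div_mul` justifies it with Fejér means.

local instance : MeasureSpace UnitAddCircle := ⟨AddCircle.haarAddCircle⟩

local instance : Measure.IsAddHaarMeasure (volume : Measure UnitAddCircle) :=
  inferInstanceAs (Measure.IsAddHaarMeasure AddCircle.haarAddCircle)

local instance : IsProbabilityMeasure (volume : Measure UnitAddCircle) :=
  inferInstanceAs (IsProbabilityMeasure AddCircle.haarAddCircle)

/-! ### Fourier coefficients on the torus -/

section Coeff

variable {ι : Type*} [Fintype ι] {f g : UnitAddTorus ι → ℂ} {n m : ι → ℤ}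

theorem coeff_def (f : UnitAddTorus ι → ℂ) (n : ι → ℤ) :
    mFourierCoeff f n = ∫ t, mFourier (-n) t * f t := by
  simp only [mFourierCoeff, smul_eq_mul]

theorem norm_mFourier_apply (n : ι → ℤ) (t : UnitAddTorus ι) : ‖mFourier n t‖ = 1 := by
  simp only [mFourier, fourier_apply, ContinuousMap.coe_mk, norm_prod, Circle.norm_coe,
    Finset.prod_const_one]

theorem measurable_mFourier (n : ι → ℤ) :
    AEStronglyMeasurable (fun t : UnitAddTorus ι => mFourier n t) volume :=
  (mFourier n).continuous.aestronglyMeasurable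

theorem integrable_mFourier_mul (n : ι → ℤ) (hf : Integrable f) :
    Integrable fun t => mFourier n t * f t :=
  hf.bdd_mul (measurable_mFourier n) (Eventually.of_forall fun t => (norm_mFourier_apply n t).le)

theorem memLp_mFourier (n : ι → ℤ) {p : ENNReal} :
    MemLp (fun t : UnitAddTorus ι => mFourier n t) p volume :=
  MemLp.of_bound (measurable_mFourier n) 1
    (Eventually.of_forall fun t => (norm_mFourier_apply n t).le)

theorem memLp_mFourier_mul (n : ι → ℤ) {p : ENNReal} (hf : MemLp f p volume) :
    MemLp (fun t => mFourier n t * f t) p volume :=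
  hf.of_le ((measurable_mFourier n).mul hf.1)
    (Eventually.of_forall fun t => by simp [norm_mFourier_apply])

theorem coeff_congr_ae (h : f =ᵐ[volume] g) (n : ι → ℤ) :
    mFourierCoeff f n = mFourierCoeff g n := by
  simp only [coeff_def]
  refine integral_congr_ae ?_
  filter_upwards [h] with t ht
  rw [ht]

theorem coeff_add (hf : Integrable f) (hg : Integrable g) (n : ι → ℤ) :
    mFourierCoeff (fun t => f t + g t) n = mFourierCoeff f n + mFourierCoeff g n := by
  simp only [coeff_def, mul_add]
  exact integral_add (integrable_mFourier_mul _ hf) (integrable_mFourier_mul _ hg)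

theorem coeff_sub (hf : Integrable f) (hg : Integrable g) (n : ι → ℤ) :
    mFourierCoeff (fun t => f t - g t) n = mFourierCoeff f n - mFourierCoeff g n := by
  simp only [coeff_def, mul_sub]
  exact integral_sub (integrable_mFourier_mul _ hf) (integrable_mFourier_mul _ hg)

theorem coeff_const_mul (c : ℂ) (f : UnitAddTorus ι → ℂ) (n : ι → ℤ) :
    mFourierCoeff (fun t => c * f t) n = c * mFourierCoeff f n := by
  simp only [coeff_def, mul_left_comm _ c]
  exact integral_const_mul _ _

theorem coeff_sum {κ : Type*} (s : Finset κ) {F : κ → UnitAddTorus ι → ℂ}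
    (hF : ∀ i ∈ s, Integrable (F i)) (n : ι → ℤ) :
    mFourierCoeff (fun t => ∑ i ∈ s, F i t) n = ∑ i ∈ s, mFourierCoeff (F i) n := by
  simp only [coeff_def, Finset.mul_sum]
  exact integral_finsetSum _ fun i hi => integrable_mFourier_mul _ (hF i hi)

theorem coeff_mFourier_mul (f : UnitAddTorus ι → ℂ) (m n : ι → ℤ) :
    mFourierCoeff (fun t => mFourier m t * f t) n = mFourierCoeff f (n - m) := by
  simp only [coeff_def, ← mul_assoc, ← mFourier_add]
  rw [show -n + m = -(n - m) by abel]

theorem coeff_conj (f : UnitAddTorus ι → ℂ) (n : ι → ℤ) :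
    mFourierCoeff (fun t => conj (f t)) n = conj (mFourierCoeff f (-n)) := by
  simp only [coeff_def, ← integral_conj, map_mul, ← mFourier_neg, neg_neg]

theorem coeff_toLp (hf : MemLp f 2 volume) (n : ι → ℤ) :
    mFourierCoeff (hf.toLp f) n = mFourierCoeff f n :=
  coeff_congr_ae hf.coeFn_toLp n

theorem ae_eq_of_coeff_eq (hf : MemLp f 2 volume) (hg : MemLp g 2 volume)
    (h : ∀ n, mFourierCoeff f n = mFourierCoeff g n) : f =ᵐ[volume] g := by
  have : hf.toLp f = hg.toLp g := by
    apply mFourierBasis.repr.injective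
    ext n
    rw [mFourierBasis_repr, mFourierBasis_repr, coeff_toLp, coeff_toLp, h]
  exact (MemLp.toLp_eq_toLp_iff hf hg).mp this

theorem coeff_one_mFourier [DecidableEq ι] (m n : ι → ℤ) :
    mFourierCoeff (fun t => mFourier m t) n = if n = m then 1 else 0 := by
  have h := orthonormal_iff_ite.mp (orthonormal_mFourier (d := ι)) n m
  rw [← h, ContinuousMap.inner_toLp, coeff_def]
  simp only [mFourier_neg, mul_comm]

/-- The Fourier coefficients of a product are given by convolution. -/
theorem hasSum_coeff_mul (hf : MemLp f 2 volume) (hg : MemLp g 2 volume) (n : ι → ℤ) :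
    HasSum (fun m => mFourierCoeff f m * mFourierCoeff g (n - m))
      (mFourierCoeff (fun t => f t * g t) n) := by
  -- Parseval for `f` and `e_n` times the conjugate of `g`: the coefficient of the latter at `m` is
  -- the conjugate of that of `g` at `n - m`.
  have hG : MemLp (fun t => mFourier n t * conj (g t)) 2 volume := memLp_mFourier_mul n hg.star
  have h := hasSum_prod_mFourierCoeff (hG.toLp _) (hf.toLp _)
  simp only [coeff_toLp, coeff_mFourier_mul, coeff_conj, Complex.conj_conj] at h
  convert! h using 1
  · ext m
    rw [neg_sub, mul_comm]
  · rw [coeff_def]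
    refine integral_congr_ae ?_
    filter_upwards [hG.coeFn_toLp, hf.coeFn_toLp] with t h1 h2
    rw [h1, h2, map_mul, ← mFourier_neg, Complex.conj_conj]
    ring

theorem norm_coeff_le {C : ℝ} (h : ∀ᵐ t, ‖f t‖ ≤ C) (n : ι → ℤ) : ‖mFourierCoeff f n‖ ≤ C := by
  rw [coeff_def]
  have := norm_integral_le_of_norm_le_const (μ := (volume : Measure (UnitAddTorus ι)))
    (f := fun t => mFourier (-n) t * f t) (C := C) (by
      filter_upwards [h] with t ht
      simpa [norm_mFourier_apply] using ht)
  simpa using this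

theorem norm_coeff_le_integral (f : UnitAddTorus ι → ℂ) (n : ι → ℤ) :
    ‖mFourierCoeff f n‖ ≤ ∫ t, ‖f t‖ := by
  rw [coeff_def]
  refine (norm_integral_le_integral_norm _).trans (le_of_eq ?_)
  simp [norm_mFourier_apply]

end Coeff

/-! ### Derivatives in terms of Fourier coefficients -/

section Deriv

variable {ι : Type*} [Fintype ι] {f g f' g' : UnitAddTorus ι → ℂ}

/-- `g` is the derivative of `f` for the Fourier multiplier `θ`. -/
def HasFourierDeriv (θ : (ι → ℤ) →+ ℂ) (f g : UnitAddTorus ι → ℂ) : Prop :=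
  ∀ n, mFourierCoeff g n = θ n * mFourierCoeff f n

theorem MemLp.integrable_two (hf : MemLp f 2 volume) : Integrable f :=
  MeasureTheory.MemLp.integrable (by norm_num) hf

theorem integrable_mul_two (hf : MemLp f 2 volume) (hg : MemLp g 2 volume) :
    Integrable fun t => f t * g t :=
  hf.integrable_mul hg

/-- The Leibniz rule is additivity of the symbol, `θ n = θ m + θ (n - m)`, inside the convolution
series. The products themselves need only be integrable. -/
theorem HasFourierDeriv.mul {θ : (ι → ℤ) →+ ℂ} (h : HasFourierDeriv θ f f')
    (k : HasFourierDeriv θ g g') (hf : MemLp f 2 volume) (hg : MemLp g 2 volume)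
    (hf' : MemLp f' 2 volume) (hg' : MemLp g' 2 volume) :
    HasFourierDeriv θ (fun t => f t * g t) fun t => f' t * g t + f t * g' t := by
  intro n
  rw [coeff_add (integrable_mul_two hf' hg) (integrable_mul_two hf hg')]
  refine ((hasSum_coeff_mul hf' hg n).add (hasSum_coeff_mul hf hg' n)).unique ?_
  convert! (hasSum_coeff_mul hf hg n).mul_left (θ n) using 2 with m
  rw [h, k, map_sub]
  ring

theorem HasFourierDeriv.conj {θ : (ι → ℤ) →+ ℂ} (h : HasFourierDeriv θ f f')
    (hθ : ∀ n, conj (θ n) = -θ n) :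
    HasFourierDeriv θ (fun t => conj (f t)) fun t => conj (f' t) := by
  intro n
  rw [coeff_conj, coeff_conj, h, map_mul, hθ, map_neg, neg_neg]

theorem HasFourierDeriv.sum {κ : Type*} {θ : (ι → ℤ) →+ ℂ} (s : Finset κ)
    {F F' : κ → UnitAddTorus ι → ℂ} (h : ∀ i ∈ s, HasFourierDeriv θ (F i) (F' i))
    (hF : ∀ i ∈ s, Integrable (F i)) (hF' : ∀ i ∈ s, Integrable (F' i)) :
    HasFourierDeriv θ (fun t => ∑ i ∈ s, F i t) fun t => ∑ i ∈ s, F' i t := by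
  intro n
  rw [coeff_sum s hF, coeff_sum s hF', Finset.mul_sum]
  exact Finset.sum_congr rfl fun i hi => h i hi n

/-- If `u` has derivatives `u₁`, `u₂` and `v` has derivatives `v₁`, `v₂`, then
`∂₁(u v₂) - ∂₂(u v₁) = u₁ v₂ - u₂ v₁`. -/
theorem coeff_curl_mul {θ₁ θ₂ : (ι → ℤ) →+ ℂ} {u u₁ u₂ v v₁ v₂ : UnitAddTorus ι → ℂ}
    (hu : MemLp u 2 volume) (hu₁ : MemLp u₁ 2 volume) (hu₂ : MemLp u₂ 2 volume)
    (hv₁ : MemLp v₁ 2 volume) (hv₂ : MemLp v₂ 2 volume)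
    (h₁ : HasFourierDeriv θ₁ u u₁) (h₂ : HasFourierDeriv θ₂ u u₂)
    (k₁ : HasFourierDeriv θ₁ v v₁) (k₂ : HasFourierDeriv θ₂ v v₂) (n : ι → ℤ) :
    θ₁ n * mFourierCoeff (fun t => u t * v₂ t) n - θ₂ n * mFourierCoeff (fun t => u t * v₁ t) n =
      mFourierCoeff (fun t => u₁ t * v₂ t) n - mFourierCoeff (fun t => u₂ t * v₁ t) n := by
  -- After splitting `θᵢ n` as `θᵢ m + θᵢ (n - m)`, the terms carrying `θ₁ (n - m) * θ₂ (n - m)`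
  -- cancel. These stand for the mixed second derivative of `v`, which therefore never has to exist.
  refine HasSum.unique (((hasSum_coeff_mul hu hv₂ n).mul_left (θ₁ n)).sub
    ((hasSum_coeff_mul hu hv₁ n).mul_left (θ₂ n))) ?_
  convert! (hasSum_coeff_mul hu₁ hv₂ n).sub (hasSum_coeff_mul hu₂ hv₁ n) using 2 with m
  rw [h₁, h₂, k₁, k₂, map_sub, map_sub]
  ring

end Deriv

/-! ### Fejér means -/

section Fejer

variable {ι : Type*} [Fintype ι] {f g : UnitAddTorus ι → ℂ}

/-- The Fejér mean of `f` attached to a finite set of frequencies. -/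
def fejer (S : Finset (ι → ℤ)) (f : UnitAddTorus ι → ℂ) (x : UnitAddTorus ι) : ℂ :=
  (S.card : ℂ)⁻¹ * ∑ k ∈ S, ∑ l ∈ S, mFourierCoeff f (k - l) * mFourier (k - l) x

theorem continuous_fejer (S : Finset (ι → ℤ)) (f : UnitAddTorus ι → ℂ) :
    Continuous (fejer S f) := by
  unfold fejer
  fun_prop

/-- The double sum over `k - l` is integration against a normalised squared modulus. Positivity of
this kernel, together with mass one from `fejer_one`, is why Fejér means preserve sup bounds. -/
theorem fejer_eq_integral (S : Finset (ι → ℤ)) (hf : Integrable f) (x : UnitAddTorus ι) :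
    fejer S f x = ∫ t, ((((S.card : ℝ)⁻¹ *
      ‖∑ k ∈ S, mFourier k x * mFourier (-k) t‖ ^ 2 : ℝ) : ℂ) * f t) := by
  have h (t : UnitAddTorus ι) : (((S.card : ℝ)⁻¹ *
      ‖∑ k ∈ S, mFourier k x * mFourier (-k) t‖ ^ 2 : ℝ) : ℂ) * f t =
      (S.card : ℂ)⁻¹ * ∑ k ∈ S, ∑ l ∈ S, mFourier (k - l) x * (mFourier (-(k - l)) t * f t) := by
    push_cast
    rw [← Complex.mul_conj', map_sum, Finset.sum_mul_sum, mul_assoc, Finset.sum_mul]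
    congr 1
    refine Finset.sum_congr rfl fun k _ => ?_
    rw [Finset.sum_mul]
    refine Finset.sum_congr rfl fun l _ => ?_
    rw [map_mul, ← mFourier_neg, ← mFourier_neg, neg_neg, sub_eq_add_neg, mFourier_add,
      neg_add, mFourier_add, neg_neg]
    ring
  simp only [h]
  rw [integral_const_mul, integral_finsetSum]
  · unfold fejer
    congr 1
    refine Finset.sum_congr rfl fun k _ => ?_
    rw [integral_finsetSum]
    · refine Finset.sum_congr rfl fun l _ => ?_
      rw [integral_const_mul, coeff_def, mul_comm]
    · exact fun l _ => (integrable_mFourier_mul _ hf).const_mul _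
  · exact fun k _ => integrable_finsetSum _ fun l _ => (integrable_mFourier_mul _ hf).const_mul _

theorem fejer_one {S : Finset (ι → ℤ)} (hS : S.Nonempty) (x : UnitAddTorus ι) :
    fejer S (fun _ => 1) x = 1 := by
  classical
  have h1 (n : ι → ℤ) : mFourierCoeff (fun _ : UnitAddTorus ι => (1 : ℂ)) n =
      if n = 0 then 1 else 0 := by
    rw [← coeff_one_mFourier]
    simp [mFourier_zero]
  have hc : (S.card : ℂ) ≠ 0 := by exact_mod_cast hS.card_pos.ne'
  unfold fejer
  simp only [h1, sub_eq_zero]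
  rw [Finset.sum_congr rfl (g := fun _ => (1 : ℂ))]
  · simp [hc]
  · intro k hk
    rw [Finset.sum_eq_single k]
    · simp [mFourier_zero]
    · intro l _ hl
      simp [hl.symm]
    · exact fun h => absurd hk h

theorem norm_fejer_le {S : Finset (ι → ℤ)} (hS : S.Nonempty) (hf : Integrable f) {C : ℝ}
    (hC : ∀ᵐ t, ‖f t‖ ≤ C) (x : UnitAddTorus ι) : ‖fejer S f x‖ ≤ C := by
  set K : UnitAddTorus ι → ℝ := fun t => (S.card : ℝ)⁻¹ *
      ‖∑ k ∈ S, mFourier k x * mFourier (-k) t‖ ^ 2 with hK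
  have hKc : Continuous K := by fun_prop
  have hK0 (t) : 0 ≤ K t := by positivity
  have hKi : Integrable K := hKc.integrable_of_hasCompactSupport (HasCompactSupport.of_compactSpace _)
  have hK1 : ∫ t, K t = 1 := by
    have := fejer_eq_integral S (integrable_const (1 : ℂ)) x
    rw [fejer_one hS] at this
    simp only [mul_one] at this
    rw [integral_complex_ofReal] at this
    exact_mod_cast this.symm
  rw [fejer_eq_integral S hf x]
  calc ‖∫ t, ((K t : ℝ) : ℂ) * f t‖ ≤ ∫ t, K t * C := by
        refine norm_integral_le_of_norm_le (hKi.mul_const C) ?_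
        filter_upwards [hC] with t ht
        rw [norm_mul, Complex.norm_real, Real.norm_of_nonneg (hK0 t)]
        exact mul_le_mul_of_nonneg_left ht (hK0 t)
    _ = C := by rw [integral_mul_const, hK1, one_mul]

/-- A Fejér mean is a trigonometric polynomial, so the convolution formula is a finite sum and the
other factor may be merely integrable. -/
theorem coeff_fejer_mul (S : Finset (ι → ℤ)) (f : UnitAddTorus ι → ℂ) (hg : Integrable g)
    (n : ι → ℤ) : mFourierCoeff (fun t => fejer S f t * g t) n =
      (S.card : ℂ)⁻¹ * ∑ k ∈ S, ∑ l ∈ S,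
        mFourierCoeff f (k - l) * mFourierCoeff g (n - (k - l)) := by
  unfold fejer
  simp only [mul_assoc, Finset.sum_mul]
  rw [coeff_const_mul, coeff_sum]
  · congr 1
    refine Finset.sum_congr rfl fun k _ => ?_
    rw [coeff_sum]
    · refine Finset.sum_congr rfl fun l _ => ?_
      rw [coeff_const_mul, coeff_mFourier_mul]
    · exact fun l _ => (integrable_mFourier_mul _ hg).const_mul _
  · exact fun k _ => integrable_finsetSum _ fun l _ => (integrable_mFourier_mul _ hg).const_mul _

/-- The multiplier of the Fejér mean. -/
def fejerWeight [DecidableEq ι] (S : Finset (ι → ℤ)) (n : ι → ℤ) : ℝ :=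
  (S.card : ℝ)⁻¹ * (S.filter fun k => k - n ∈ S).card

theorem coeff_fejer [DecidableEq ι] (S : Finset (ι → ℤ)) (f : UnitAddTorus ι → ℂ) (n : ι → ℤ) :
    mFourierCoeff (fejer S f) n = fejerWeight S n * mFourierCoeff f n := by
  have h := coeff_fejer_mul S f (integrable_const (1 : ℂ)) n
  have h1 (n : ι → ℤ) : mFourierCoeff (fun _ : UnitAddTorus ι => (1 : ℂ)) n =
      if n = 0 then 1 else 0 := by
    rw [← coeff_one_mFourier]
    simp [mFourier_zero]
  simp only [mul_one, h1] at h
  refine h.trans ?_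
  unfold fejerWeight
  push_cast
  rw [mul_assoc]
  congr 1
  rw [Finset.card_filter, Nat.cast_sum, Finset.sum_mul]
  refine Finset.sum_congr rfl fun k _ => ?_
  by_cases hk : k - n ∈ S
  · rw [Finset.sum_eq_single (k - n)]
    · simp [hk]
    · intro l _ hl
      rw [if_neg, mul_zero]
      intro h0
      apply hl
      rw [sub_eq_zero] at h0
      rw [h0]; abel
    · exact fun h' => absurd hk h'
  · rw [Finset.sum_eq_zero]
    · simp [hk]
    · intro l hl
      rw [if_neg, mul_zero]
      intro h0
      apply hk
      rw [sub_eq_zero] at h0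
      rw [h0]; simpa using hl

theorem fejerWeight_nonneg [DecidableEq ι] (S : Finset (ι → ℤ)) (n : ι → ℤ) :
    0 ≤ fejerWeight S n := by
  unfold fejerWeight; positivity

theorem fejerWeight_le_one [DecidableEq ι] (S : Finset (ι → ℤ)) (n : ι → ℤ) :
    fejerWeight S n ≤ 1 := by
  unfold fejerWeight
  rcases S.eq_empty_or_nonempty with rfl | hS
  · simp
  · rw [inv_mul_le_iff₀ (by exact_mod_cast hS.card_pos), mul_one]
    exact_mod_cast Finset.card_filter_le _ _

/-- The discrete box `[0, N]^ι`. -/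
def box (ι : Type*) [Fintype ι] [DecidableEq ι] (N : ℕ) : Finset (ι → ℤ) :=
  Finset.Icc 0 (fun _ => (N : ℤ))

theorem box_nonempty [DecidableEq ι] (N : ℕ) : (box ι N).Nonempty :=
  ⟨0, Finset.mem_Icc.mpr ⟨le_rfl, fun _ => Int.natCast_nonneg N⟩⟩

/-- The weight is the proportion of the box that stays in the box after a shift by `n`, eventually
`∏ (1 - |n i| / (N + 1))`. -/
theorem tendsto_fejerWeight [DecidableEq ι] (n : ι → ℤ) :
    Tendsto (fun N => fejerWeight (box ι N) n) atTop (𝓝 1) := by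
  have hcard (N : ℕ) : ((box ι N).card : ℝ) = ∏ _i : ι, ((N : ℝ) + 1) := by
    rw [box, Pi.card_Icc]
    push_cast
    refine Finset.prod_congr rfl fun i _ => ?_
    simp
  have hfilt (N : ℕ) : (box ι N).filter (fun k => k - n ∈ box ι N) =
      Finset.Icc (fun i => max 0 (n i)) (fun i => min (N : ℤ) (N + n i)) := by
    ext k
    simp only [box, Finset.mem_filter, Finset.mem_Icc, Pi.le_def, Pi.zero_apply, Pi.sub_apply,
      max_le_iff, le_min_iff]
    constructor
    · rintro ⟨⟨h1, h2⟩, h3, h4⟩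
      exact ⟨fun i => ⟨h1 i, by linarith [h3 i]⟩, fun i => ⟨h2 i, by linarith [h4 i]⟩⟩
    · rintro ⟨h1, h2⟩
      exact ⟨⟨fun i => (h1 i).1, fun i => (h2 i).1⟩, fun i => by linarith [(h1 i).2],
        fun i => by linarith [(h2 i).2]⟩
  -- The product formula needs `|n i| ≤ N` for every `i`; beyond that the true overlap is empty
  -- while a factor would be negative or zero.
  have hev : ∀ᶠ N : ℕ in atTop, ∏ i : ι, (1 - (|n i| : ℝ) / ((N : ℝ) + 1)) =
      fejerWeight (box ι N) n := by
    have : ∀ᶠ N : ℕ in atTop, ∀ i : ι, |n i| ≤ (N : ℤ) := by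
      rw [eventually_all]
      intro i
      filter_upwards [eventually_ge_atTop (n i).natAbs] with N hN
      rw [Int.abs_eq_natAbs]
      exact_mod_cast hN
    filter_upwards [this] with N hN
    unfold fejerWeight
    rw [hcard, hfilt, Pi.card_Icc]
    push_cast
    rw [← Finset.prod_inv_distrib, ← Finset.prod_mul_distrib]
    refine Finset.prod_congr rfl fun i _ => ?_
    have hN1 : (N : ℝ) + 1 ≠ 0 := by positivity
    have hi : (((Finset.Icc (max 0 (n i)) (min (N : ℤ) (N + n i))).card : ℤ) : ℝ) =
        (N : ℝ) + 1 - |(n i : ℝ)| := by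
      rw [Int.card_Icc, Int.toNat_of_nonneg]
      · rcases le_total 0 (n i) with h | h
        · rw [max_eq_right h, min_eq_left (by omega), abs_of_nonneg (by exact_mod_cast h)]
          push_cast; ring
        · rw [max_eq_left h, min_eq_right (by omega), abs_of_nonpos (by exact_mod_cast h)]
          push_cast; ring
      · have := hN i
        rw [abs_le] at this
        omega
    rw [show (((Finset.Icc (max 0 (n i)) (min (N : ℤ) (N + n i))).card : ℕ) : ℝ) =
      (N : ℝ) + 1 - |(n i : ℝ)| by exact_mod_cast hi]
    field_simp
  refine Tendsto.congr' hev ?_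
  have : Tendsto (fun N : ℕ => ∏ i : ι, (1 - (|n i| : ℝ) / ((N : ℝ) + 1))) atTop
      (𝓝 (∏ _i : ι, (1 - 0 : ℝ))) := by
    refine tendsto_finsetProd _ fun i _ => tendsto_const_nhds.sub ?_
    exact tendsto_const_nhds.div_atTop
      (tendsto_atTop_add_const_right _ _ tendsto_natCast_atTop_atTop)
  simpa using this

theorem memLp_fejer (S : Finset (ι → ℤ)) (f : UnitAddTorus ι → ℂ) {p : ENNReal} :
    MemLp (fejer S f) p volume := by
  obtain ⟨C, hC⟩ := (isCompact_univ (X := UnitAddTorus ι)).exists_bound_of_continuousOn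
    (continuous_fejer S f).continuousOn
  exact MemLp.of_bound (continuous_fejer S f).aestronglyMeasurable C
    (Eventually.of_forall fun t => hC t (mem_univ t))

/-- Dominated convergence in the convolution series: the weights lie in `[0, 1]` and tend to one. -/
theorem tendsto_coeff_fejer_mul [DecidableEq ι] (hf : MemLp f 2 volume) (hg : MemLp g 2 volume)
    (n : ι → ℤ) : Tendsto (fun N => mFourierCoeff (fun t => fejer (box ι N) f t * g t) n) atTop
      (𝓝 (mFourierCoeff (fun t => f t * g t) n)) := by
  rw [← (hasSum_coeff_mul hf hg n).tsum_eq]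
  simp only [← (hasSum_coeff_mul (memLp_fejer _ f) hg n).tsum_eq, coeff_fejer]
  refine tendsto_tsum_of_dominated_convergence
    (hasSum_coeff_mul hf hg n).summable.norm (fun m => ?_) (Eventually.of_forall fun N m => ?_)
  · have := (Complex.continuous_ofReal.tendsto 1).comp (tendsto_fejerWeight m)
    simpa [mul_assoc] using this.mul_const (mFourierCoeff f m * mFourierCoeff g (n - m))
  · rw [mul_assoc, norm_mul, Complex.norm_real, Real.norm_of_nonneg (fejerWeight_nonneg _ _)]
    exact mul_le_of_le_one_left (norm_nonneg _) (fejerWeight_le_one _ _)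

/-- For integrable `g` the convolution series may diverge. Instead `g` is approximated in `L¹` by
trigonometric polynomials, to which the square-integrable case applies; the common bound `C` on `f`
and on its Fejér means controls the error uniformly in `N`. -/
theorem tendsto_coeff_fejer_mul_of_bounded [DecidableEq ι] (hf : Integrable f) {C : ℝ}
    (hC : ∀ᵐ t, ‖f t‖ ≤ C) (hg : Integrable g) (n : ι → ℤ) :
    Tendsto (fun N => mFourierCoeff (fun t => fejer (box ι N) f t * g t) n) atTop
      (𝓝 (mFourierCoeff (fun t => f t * g t) n)) := by
  have hf2 : MemLp f 2 volume := MemLp.of_bound hf.1 C hC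
  have hC0 : 0 ≤ C := by
    obtain ⟨t, ht⟩ := hC.exists
    exact (norm_nonneg _).trans ht
  have hfm {h : UnitAddTorus ι → ℂ} (hh : Integrable h) : Integrable fun t => f t * h t :=
    hh.bdd_mul hf.1 hC
  have hFm {h : UnitAddTorus ι → ℂ} (hh : Integrable h) (N : ℕ) :
      Integrable fun t => fejer (box ι N) f t * h t :=
    hh.bdd_mul (continuous_fejer _ f).aestronglyMeasurable
      (Eventually.of_forall fun t => norm_fejer_le (box_nonempty N) hf hC t)
  have key (h : Lp ℂ 1 (volume : Measure (UnitAddTorus ι)))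
      (hh : h ∈ Submodule.span ℂ (Set.range (mFourierLp (d := ι) 1))) :
      MemLp (fun t => h t) 2 volume := by
    induction hh using Submodule.span_induction with
    | mem x hx =>
      obtain ⟨m, rfl⟩ := hx
      exact (memLp_congr_ae (coeFn_mFourierLp 1 m)).mpr (memLp_mFourier m)
    | zero => exact (memLp_congr_ae (Lp.coeFn_zero _ _ _)).mpr (MemLp.zero (ε := ℂ))
    | add x y _ _ hx hy => exact (memLp_congr_ae (Lp.coeFn_add x y)).mpr (hx.add hy)
    | smul a x _ hx => exact (memLp_congr_ae (Lp.coeFn_smul a x)).mpr (hx.const_smul a)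
  rw [Metric.tendsto_atTop]
  intro ε hε
  have hg1 : MemLp g 1 volume := memLp_one_iff_integrable.mpr hg
  have hcl : hg1.toLp g ∈ (Submodule.span ℂ (Set.range (mFourierLp (d := ι) 1))).topologicalClosure := by
    rw [span_mFourierLp_closure_eq_top (by simp)]
    trivial
  rw [← SetLike.mem_coe, Submodule.topologicalClosure_coe, Metric.mem_closure_iff] at hcl
  -- Using `C + 1` rather than `C` keeps the tolerance meaningful when `C = 0`.
  obtain ⟨h, hh, hd⟩ := hcl (ε / (3 * (C + 1))) (by positivity)
  have hh2 := key h hh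
  have hhi : Integrable fun t => h t := MemLp.integrable_two hh2
  have hd' : ∫ t, ‖g t - h t‖ < ε / (3 * (C + 1)) := by
    rw [dist_eq_norm, L1.norm_eq_integral_norm] at hd
    refine lt_of_eq_of_lt (integral_congr_ae ?_) hd
    filter_upwards [Lp.coeFn_sub (hg1.toLp g) h, hg1.coeFn_toLp] with t h1 h2
    rw [h1, Pi.sub_apply, h2]
  have hbound {F : UnitAddTorus ι → ℂ} (hF : AEStronglyMeasurable F volume)
      (hFC : ∀ᵐ t, ‖F t‖ ≤ C) :
      ‖mFourierCoeff (fun t => F t * g t) n - mFourierCoeff (fun t => F t * h t) n‖ ≤ ε / 3 := by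
    rw [← coeff_sub (hg.bdd_mul hF hFC) (hhi.bdd_mul hF hFC)]
    calc _ ≤ ∫ t, ‖F t * g t - F t * h t‖ := norm_coeff_le_integral _ n
      _ ≤ ∫ t, C * ‖g t - h t‖ := by
        refine integral_mono_ae ((hg.bdd_mul hF hFC).sub (hhi.bdd_mul hF hFC)).norm
          ((hg.sub hhi).norm.const_mul C) ?_
        filter_upwards [hFC] with t ht
        simp only [← mul_sub, norm_mul]
        exact mul_le_mul_of_nonneg_right ht (norm_nonneg _)
      _ = C * ∫ t, ‖g t - h t‖ := integral_const_mul _ _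
      _ ≤ (C + 1) * (ε / (3 * (C + 1))) :=
        mul_le_mul (by linarith) hd'.le (integral_nonneg fun _ => norm_nonneg _) (by linarith)
      _ = ε / 3 := by field_simp
  have hlim := Metric.tendsto_atTop.mp (tendsto_coeff_fejer_mul hf2 hh2 n) (ε / 3) (by positivity)
  obtain ⟨N₀, hN₀⟩ := hlim
  refine ⟨N₀, fun N hN => ?_⟩
  have h1 := hbound (continuous_fejer (box ι N) f).aestronglyMeasurable
    (Eventually.of_forall fun t => norm_fejer_le (box_nonempty N) hf hC t)
  have h2 := hbound hf.1 hC
  have h3 := hN₀ N hN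
  rw [dist_eq_norm] at h3 ⊢
  set a := mFourierCoeff (fun t => fejer (box ι N) f t * g t) n
  set b := mFourierCoeff (fun t => fejer (box ι N) f t * h t) n
  set c := mFourierCoeff (fun t => f t * h t) n
  set e := mFourierCoeff (fun t => f t * g t) n
  calc ‖a - e‖ = ‖(a - b) + (b - c) - (e - c)‖ := by congr 1; ring
    _ ≤ ‖a - b‖ + ‖b - c‖ + ‖e - c‖ := (norm_sub_le _ _).trans (by gcongr; exact norm_add_le _ _)
    _ < ε := by linarith

/-- A divergence `∑ ∂ⱼ gⱼ = F` with integrable `F` may be multiplied by a bounded function with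
square-integrable derivatives. -/
theorem coeff_div_mul {κ : Type*} [Fintype κ] {θ : κ → (ι → ℤ) →+ ℂ}
    {u F : UnitAddTorus ι → ℂ} {Du G : κ → UnitAddTorus ι → ℂ} {C : ℝ}
    (hu : AEStronglyMeasurable u volume) (hC : ∀ᵐ t, ‖u t‖ ≤ C)
    (hDu : ∀ j, MemLp (Du j) 2 volume) (hd : ∀ j, HasFourierDeriv (θ j) u (Du j))
    (hG : ∀ j, MemLp (G j) 2 volume) (hF : Integrable F)
    (hdiv : ∀ n, ∑ j, θ j n * mFourierCoeff (G j) n = mFourierCoeff F n) (n : ι → ℤ) :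
    ∑ j, θ j n * mFourierCoeff (fun t => u t * G j t) n =
      ∑ j, mFourierCoeff (fun t => Du j t * G j t) n + mFourierCoeff (fun t => u t * F t) n := by
  classical
  have hu2 : MemLp u 2 volume := MemLp.of_bound hu C hC
  have hui := MemLp.integrable_two hu2
  -- With `u` replaced by its Fejér means both sides are finite sums and the identity is algebra.
  -- The square-integrable products and the bounded-times-integrable one pass to the limit by the
  -- two preceding convergence lemmas.
  have h1 : Tendsto (fun N => ∑ j, θ j n *
      mFourierCoeff (fun t => fejer (box ι N) u t * G j t) n) atTop
      (𝓝 (∑ j, θ j n * mFourierCoeff (fun t => u t * G j t) n)) :=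
    tendsto_finsetSum _ fun j _ => (tendsto_coeff_fejer_mul hu2 (hG j) n).const_mul _
  have h2 : Tendsto (fun N => ∑ j, mFourierCoeff (fun t => fejer (box ι N) (Du j) t * G j t) n +
      mFourierCoeff (fun t => fejer (box ι N) u t * F t) n) atTop
      (𝓝 (∑ j, mFourierCoeff (fun t => Du j t * G j t) n +
        mFourierCoeff (fun t => u t * F t) n)) :=
    (tendsto_finsetSum _ fun j _ => tendsto_coeff_fejer_mul (hDu j) (hG j) n).add
      (tendsto_coeff_fejer_mul_of_bounded hui hC hF n)
  refine tendsto_nhds_unique h1 (h2.congr fun N => ?_)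
  simp only [coeff_fejer_mul _ _ (MemLp.integrable_two (hG _)), coeff_fejer_mul _ _ hF,
    ← hdiv, hd _ _]
  simp only [Finset.mul_sum]
  rw [Finset.sum_comm (s := (Finset.univ : Finset κ)) (t := box ι N)]
  rw [Finset.sum_comm (s := (Finset.univ : Finset κ)) (t := box ι N)]
  rw [← Finset.sum_add_distrib]
  refine Finset.sum_congr rfl fun k _ => ?_
  rw [Finset.sum_comm (s := (Finset.univ : Finset κ)) (t := box ι N)]
  rw [Finset.sum_comm (s := (Finset.univ : Finset κ)) (t := box ι N)]
  rw [← Finset.sum_add_distrib]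
  refine Finset.sum_congr rfl fun l _ => ?_
  rw [← Finset.sum_add_distrib]
  refine Finset.sum_congr rfl fun j _ => ?_
  -- The product rule at the level of symbols: one part differentiates `u`, the other produces the
  -- divergence of `G`.
  have : θ j n = θ j (k - l) + θ j (n - (k - l)) := by rw [← map_add]; congr 1; abel
  rw [this]
  ring

end Fejer

/-! ### Exponentially decaying families on `ℤ^ι` -/

section Decay

variable {ι : Type*} [Fintype ι]

theorem summable_exp_neg_mul_abs_int {δ : ℝ} (hδ : 0 < δ) :
    Summable fun k : ℤ => Real.exp (-(δ * |(k : ℝ)|)) := by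
  have h : Summable fun k : ℕ => Real.exp (-(δ * (k : ℝ))) := by
    have := Real.summable_exp_nat_mul_iff.mpr (neg_neg_of_pos hδ)
    refine this.congr fun k => ?_
    congr 1; ring
  refine Summable.of_nat_of_neg ?_ ?_
  · simpa using h
  · simpa using h

theorem summable_exp_neg_mul_norm {ε : ℝ} (hε : 0 < ε) :
    Summable fun n : ι → ℤ => Real.exp (-(ε * ‖n‖)) := by
  classical
  -- In the sup norm `∑ |n i| ≤ card ι * ‖n‖`, so this `δ` dominates the exponential by a product of
  -- one-dimensional ones. The `+ 1` covers empty `ι`.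
  set δ : ℝ := ε / (Fintype.card ι + 1) with hδ
  have hδ0 : 0 < δ := by positivity
  set g : ℤ → ℝ := fun k => Real.exp (-(δ * |(k : ℝ)|)) with hg
  have hgs : Summable g := summable_exp_neg_mul_abs_int hδ0
  have hprod : Summable fun n : ι → ℤ => ∏ i, g (n i) := by
    refine summable_of_sum_le (c := ∏ _i : ι, ∑' k, g k)
      (fun n => Finset.prod_nonneg fun i _ => (Real.exp_pos _).le) fun u => ?_
    calc ∑ n ∈ u, ∏ i, g (n i)
        ≤ ∑ n ∈ Fintype.piFinset fun i => u.image fun n => n i, ∏ i, g (n i) := by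
          refine Finset.sum_le_sum_of_subset_of_nonneg (fun n hn => ?_)
            fun n _ _ => Finset.prod_nonneg fun i _ => (Real.exp_pos _).le
          exact Fintype.mem_piFinset.mpr fun i => Finset.mem_image_of_mem _ hn
      _ = ∏ i, ∑ k ∈ u.image fun n => n i, g k := (Finset.prod_univ_sum _ _).symm
      _ ≤ ∏ _i : ι, ∑' k, g k :=
          Finset.prod_le_prod (fun i _ => Finset.sum_nonneg fun k _ => (Real.exp_pos _).le)
            fun i _ => hgs.sum_le_tsum _ fun k _ => (Real.exp_pos _).le
  refine Summable.of_nonneg_of_le (fun n => (Real.exp_pos _).le) (fun n => ?_) hprod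
  simp only [hg]
  rw [← Real.exp_sum, Real.exp_le_exp, Finset.sum_neg_distrib, neg_le_neg_iff, ← Finset.mul_sum]
  have h1 : ∑ i, |((n i : ℤ) : ℝ)| ≤ Fintype.card ι * ‖n‖ := by
    have := Finset.sum_le_card_nsmul Finset.univ (fun i => |((n i : ℤ) : ℝ)|) ‖n‖ fun i _ => by
      simpa [Int.norm_eq_abs] using norm_le_pi_norm n i
    simpa using this
  calc δ * ∑ i, |((n i : ℤ) : ℝ)| ≤ δ * ((Fintype.card ι + 1) * ‖n‖) := by
        gcongr
        exact h1.trans (by gcongr; linarith)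
    _ = ε * ‖n‖ := by rw [hδ]; field_simp

/-- Exponential decay of a family indexed by `ℤ^ι`. -/
def ExpDecay (a : (ι → ℤ) → ℂ) : Prop :=
  ∃ C ε : ℝ, 0 ≤ C ∧ 0 < ε ∧ ∀ n, ‖a n‖ ≤ C * Real.exp (-(ε * ‖n‖))

theorem ExpDecay.of_norm_le {a b : (ι → ℤ) → ℂ} (ha : ExpDecay a) {K : ℝ}
    (h : ∀ n, ‖b n‖ ≤ K * ‖a n‖) : ExpDecay b := by
  obtain ⟨C, ε, hC, hε, H⟩ := ha
  refine ⟨|K| * C, ε, by positivity, hε, fun n => (h n).trans ?_⟩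
  rw [mul_assoc]
  exact mul_le_mul (le_abs_self K) (H n) (norm_nonneg _) (abs_nonneg K)

theorem ExpDecay.exists_common {κ : Type*} [Finite κ] {a : κ → (ι → ℤ) → ℂ}
    (ha : ∀ i, ExpDecay (a i)) :
    ∃ C ε : ℝ, 0 ≤ C ∧ 0 < ε ∧ ∀ i n, ‖a i n‖ ≤ C * Real.exp (-(ε * ‖n‖)) := by
  choose C ε hC hε H using ha
  cases nonempty_fintype κ
  obtain ⟨ε₀, hε₀, hle⟩ : ∃ ε₀ > 0, ∀ i, ε₀ ≤ ε i := by
    rcases isEmpty_or_nonempty κ with h | h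
    · exact ⟨1, one_pos, fun i => h.elim i⟩
    · obtain ⟨i₀, h₀⟩ := Finite.exists_min ε
      exact ⟨ε i₀, hε i₀, h₀⟩
  refine ⟨∑ i, C i, ε₀, Finset.sum_nonneg fun i _ => hC i, hε₀, fun i n => (H i n).trans ?_⟩
  gcongr
  · exact Finset.sum_nonneg fun i _ => hC i
  · exact Finset.single_le_sum (f := C) (fun i _ => hC i) (Finset.mem_univ i)
  · exact hle i

theorem ExpDecay.sum {κ : Type*} [Fintype κ] {a : κ → (ι → ℤ) → ℂ}
    (ha : ∀ i, ExpDecay (a i)) : ExpDecay fun n => ∑ i, a i n := by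
  obtain ⟨C, ε, hC, hε, H⟩ := ExpDecay.exists_common ha
  refine ⟨Fintype.card κ * C, ε, by positivity, hε, fun n => ?_⟩
  have := norm_sum_le_of_le Finset.univ fun i _ => H i n
  simpa [mul_assoc] using this

theorem ExpDecay.add {a b : (ι → ℤ) → ℂ} (ha : ExpDecay a) (hb : ExpDecay b) :
    ExpDecay fun n => a n + b n := by
  have := ExpDecay.sum (a := ![a, b]) (by simp [Fin.forall_fin_two, ha, hb])
  simpa using this

theorem ExpDecay.of_finite_support {a : (ι → ℤ) → ℂ} {s : Finset (ι → ℤ)}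
    (h : ∀ n ∉ s, a n = 0) : ExpDecay a := by
  refine ⟨∑ n ∈ s, ‖a n‖ * Real.exp ‖n‖, 1, by positivity, one_pos, fun n => ?_⟩
  by_cases hn : n ∈ s
  · rw [one_mul, Real.exp_neg, ← div_eq_mul_inv, le_div_iff₀ (Real.exp_pos _)]
    exact Finset.single_le_sum (f := fun n => ‖a n‖ * Real.exp ‖n‖)
      (fun i _ => by positivity) hn
  · rw [h n hn, norm_zero]; positivity

theorem ExpDecay.summable_norm {a : (ι → ℤ) → ℂ} (ha : ExpDecay a) : Summable fun n => ‖a n‖ := by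
  obtain ⟨C, ε, -, hε, H⟩ := ha
  exact Summable.of_nonneg_of_le (fun _ => norm_nonneg _) H
    ((summable_exp_neg_mul_norm hε).mul_left C)

/-- A bounded solution of the convolution inequality `‖n‖ b n ≤ K ∑ₘ e^{-ε‖m‖} b (n - m)` decays
exponentially. -/
theorem exp_decay_of_conv_le {b : (ι → ℤ) → ℝ} {K ε M : ℝ} (hK : 0 ≤ K) (hε : 0 < ε)
    (hb : ∀ n, 0 ≤ b n) (hM : ∀ n, b n ≤ M)
    (h : ∀ n, ‖n‖ * b n ≤ K * ∑' m, Real.exp (-(ε * ‖m‖)) * b (n - m)) :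
    ∃ C, 0 ≤ C ∧ ∀ n, b n ≤ C * Real.exp (-(ε / 2 * ‖n‖)) := by
  set δ := ε / 2 with hδ
  have hδ0 : 0 < δ := by positivity
  have hM0 : 0 ≤ M := (hb 0).trans (hM 0)
  set Z := ∑' m : ι → ℤ, Real.exp (-(δ * ‖m‖)) with hZ
  have hZs : Summable fun m : ι → ℤ => Real.exp (-(δ * ‖m‖)) := summable_exp_neg_mul_norm hδ0
  have hZ0 : 0 ≤ Z := tsum_nonneg fun m => (Real.exp_pos _).le
  set C₀ := Real.exp (δ * (2 * K * Z)) * M with hC₀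
  have hC₀0 : 0 ≤ C₀ := by positivity
  -- Truncating the weight at `R` makes the weighted supremum `S` finite in advance, so it can be
  -- absorbed. The resulting bound `C₀` does not depend on `R`.
  have key (R : ℝ) (hR : 1 ≤ R) (n : ι → ℤ) : min (Real.exp (δ * ‖n‖)) R * b n ≤ C₀ := by
    set w : (ι → ℤ) → ℝ := fun n => min (Real.exp (δ * ‖n‖)) R with hw
    have hw0 (n) : 0 ≤ w n := le_min (Real.exp_pos _).le (by linarith)
    have hbdd : BddAbove (Set.range fun n => w n * b n) :=
      ⟨R * M, by
        rintro _ ⟨n, rfl⟩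
        exact mul_le_mul (min_le_right _ _) (hM n) (hb n) (by linarith)⟩
    set S := ⨆ n, w n * b n with hS
    have hle (n) : w n * b n ≤ S := le_ciSup hbdd n
    have hS0 : 0 ≤ S := (mul_nonneg (hw0 0) (hb 0)).trans (hle 0)
    -- Submultiplicativity survives the truncation because `R ≤ exp (δ * ‖m‖) * R`.
    have hsub (n m : ι → ℤ) : w n ≤ Real.exp (δ * ‖m‖) * w (n - m) := by
      have h1 : 1 ≤ Real.exp (δ * ‖m‖) := Real.one_le_exp (by positivity)
      rw [hw, mul_min_of_nonneg _ _ (Real.exp_pos _).le]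
      refine min_le_min ?_ (by nlinarith)
      rw [← Real.exp_add, Real.exp_le_exp, ← mul_add]
      gcongr
      simpa using norm_add_le m (n - m)
    -- Since `ε = 2 δ`, half of the kernel's decay pays for moving the weight from `n` to `n - m`
    -- and the other half keeps the sum finite.
    have hconv (n) : ‖n‖ * (w n * b n) ≤ K * Z * S := by
      have hsum1 : Summable fun m => Real.exp (-(ε * ‖m‖)) * b (n - m) :=
        Summable.of_nonneg_of_le (fun m => mul_nonneg (Real.exp_pos _).le (hb _))
          (fun m => mul_le_mul_of_nonneg_left (hM _) (Real.exp_pos _).le)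
          ((summable_exp_neg_mul_norm hε).mul_right M)
      calc ‖n‖ * (w n * b n) = w n * (‖n‖ * b n) := by ring
        _ ≤ w n * (K * ∑' m, Real.exp (-(ε * ‖m‖)) * b (n - m)) :=
          mul_le_mul_of_nonneg_left (h n) (hw0 n)
        _ = K * ∑' m, w n * (Real.exp (-(ε * ‖m‖)) * b (n - m)) := by
          rw [tsum_mul_left]; ring
        _ ≤ K * ∑' m, Real.exp (-(δ * ‖m‖)) * S := by
          refine mul_le_mul_of_nonneg_left ?_ hK
          refine Summable.tsum_le_tsum (fun m => ?_) (hsum1.mul_left _) (hZs.mul_right S)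
          have he : Real.exp (-(ε * ‖m‖)) = Real.exp (-(δ * ‖m‖)) * Real.exp (-(δ * ‖m‖)) := by
            rw [← Real.exp_add]; congr 1; rw [hδ]; ring
          have hinv : Real.exp (-(δ * ‖m‖)) * Real.exp (δ * ‖m‖) = 1 := by
            rw [← Real.exp_add]; simp
          calc w n * (Real.exp (-(ε * ‖m‖)) * b (n - m))
              ≤ (Real.exp (δ * ‖m‖) * w (n - m)) * (Real.exp (-(ε * ‖m‖)) * b (n - m)) :=
                mul_le_mul_of_nonneg_right (hsub n m) (mul_nonneg (Real.exp_pos _).le (hb _))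
            _ = (Real.exp (-(δ * ‖m‖)) * Real.exp (δ * ‖m‖)) *
                  (Real.exp (-(δ * ‖m‖)) * (w (n - m) * b (n - m))) := by rw [he]; ring
            _ ≤ Real.exp (-(δ * ‖m‖)) * S := by
                rw [hinv, one_mul]
                exact mul_le_mul_of_nonneg_left (hle _) (Real.exp_pos _).le
        _ = K * Z * S := by rw [tsum_mul_right]; ring
    -- The factor `‖n‖` gains one half once `‖n‖ > 2 K Z`, and the remaining frequencies are bounded
    -- by `C₀` directly. Hence `S ≤ max (S / 2) C₀`, which for finite nonnegative `S` gives `S ≤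
    -- C₀`.
    have hmax (n) : w n * b n ≤ max (S / 2) C₀ := by
      rcases le_or_gt ‖n‖ (2 * K * Z) with hn | hn
      · refine le_max_of_le_right (mul_le_mul ?_ (hM n) (hb n) (Real.exp_pos _).le)
        exact (min_le_left _ _).trans (Real.exp_le_exp.mpr (by gcongr))
      · refine le_max_of_le_left ?_
        have hn0 : 0 < ‖n‖ := lt_of_le_of_lt (by positivity) hn
        have h1 := hconv n
        have h2 : K * Z * S ≤ ‖n‖ * (S / 2) := by nlinarith
        exact le_of_mul_le_mul_left (h1.trans h2) hn0
    have hSle : S ≤ max (S / 2) C₀ := ciSup_le hmax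
    rcases le_max_iff.mp hSle with h1 | h1
    · exact (hle n).trans (by linarith)
    · exact (hle n).trans h1
  refine ⟨C₀, hC₀0, fun n => ?_⟩
  -- The truncation level is chosen at the weight of `n` itself, where it has no effect.
  have := key (Real.exp (δ * ‖n‖)) (Real.one_le_exp (by positivity)) n
  rw [min_self] at this
  rw [Real.exp_neg, ← div_eq_mul_inv, le_div_iff₀ (Real.exp_pos _), mul_comm]
  exact this

end Decay

/-! ### Real-analytic functions and exponential decay -/

section Analytic

variable {ι : Type*} [Fintype ι] {E : Type*} [NormedAddCommGroup E] [NormedSpace ℝ E]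

/-- Each exponential is expanded in powers of `y` about `x₀` and the double series is summed in the
other order. Imaginary exponents have modulus-one exponentials, so the coefficients at `x₀` decay
exactly as those of `a`. -/
theorem analyticOnNhd_tsum_exp {a : (ι → ℤ) → ℂ} (ha : ExpDecay a)
    (ℓ : (ι → ℤ) → E →L[ℝ] ℂ) {M : ℝ} (hM : 0 ≤ M) (hℓ : ∀ n, ‖ℓ n‖ ≤ M * ‖n‖)
    (hre : ∀ n x, (ℓ n x).re = 0) :
    AnalyticOnNhd ℝ (fun x => ∑' n, a n * Complex.exp (ℓ n x)) Set.univ := by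
  intro x₀ _
  obtain ⟨C, ε, hC, hε, H⟩ := ha
  set c : (ι → ℤ) → ℂ := fun n => a n * Complex.exp (ℓ n x₀) with hc
  have hcn (n) : ‖c n‖ ≤ C * Real.exp (-(ε * ‖n‖)) := by
    simpa [hc, Complex.norm_exp, hre] using H n
  -- On this radius `‖ℓ n y‖ ≤ (ε / 2) ‖n‖`: the expansion costs half of the decay and the other
  -- half is left for summing over `n`.
  set r : ℝ := ε / (2 * (M + 1)) with hr
  have hr0 : 0 < r := by positivity
  have hMr : M * r ≤ ε / 2 := by
    rw [hr, mul_div_assoc', div_le_div_iff₀ (by positivity) (by positivity)]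
    nlinarith
  set τ : (q : ℕ) → (ι → ℤ) → ContinuousMultilinearMap ℝ (fun _ : Fin q => E) ℂ := fun q n =>
    (c n / (q.factorial : ℂ)) •
      (ContinuousMultilinearMap.mkPiAlgebraFin ℝ q ℂ).compContinuousLinearMap fun _ => ℓ n
  have hτ_apply (q n) (y : E) : τ q n (fun _ => y) = c n * (ℓ n y ^ q / (q.factorial : ℂ)) := by
    simp [τ]
    ring
  have hτ (q n) : ‖τ q n‖ * r ^ q ≤ C * Real.exp (-(ε / 2 * ‖n‖)) := by
    have h1 : ‖τ q n‖ ≤ ‖c n‖ / q.factorial * ‖ℓ n‖ ^ q := by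
      simp only [τ]
      rw [norm_smul, norm_div, Complex.norm_natCast]
      refine mul_le_mul_of_nonneg_left ?_ (by positivity)
      refine (ContinuousMultilinearMap.norm_compContinuousLinearMap_le _ _).trans ?_
      simp
    calc ‖τ q n‖ * r ^ q ≤ (‖c n‖ / q.factorial * ‖ℓ n‖ ^ q) * r ^ q := by gcongr
      _ = ‖c n‖ * ((‖ℓ n‖ * r) ^ q / q.factorial) := by rw [mul_pow]; ring
      _ ≤ (C * Real.exp (-(ε * ‖n‖))) * Real.exp (ε / 2 * ‖n‖) := by
        refine mul_le_mul (hcn n) ?_ (by positivity) (by positivity)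
        refine (Real.pow_div_factorial_le_exp _ (by positivity) q).trans ?_
        rw [Real.exp_le_exp]
        calc ‖ℓ n‖ * r ≤ (M * ‖n‖) * r := by gcongr; exact hℓ n
          _ = (M * r) * ‖n‖ := by ring
          _ ≤ ε / 2 * ‖n‖ := by gcongr
      _ = C * Real.exp (-(ε / 2 * ‖n‖)) := by
        rw [mul_assoc, ← Real.exp_add]; congr 2; ring
  have hsum : Summable fun n : ι → ℤ => C * Real.exp (-(ε / 2 * ‖n‖)) :=
    (summable_exp_neg_mul_norm (by positivity)).mul_left C
  have hτs (q) : Summable fun n => ‖τ q n‖ := by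
    refine Summable.of_nonneg_of_le (fun _ => norm_nonneg _) (fun n => ?_)
      (hsum.mul_right ((r ^ q)⁻¹))
    rw [← div_eq_mul_inv, le_div_iff₀ (by positivity)]
    exact hτ q n
  let p : FormalMultilinearSeries ℝ E ℂ := fun q => ∑' n, τ q n
  have hp : HasFPowerSeriesOnBall (fun x => ∑' n, a n * Complex.exp (ℓ n x)) p x₀
      (ENNReal.ofReal r) := by
    refine ⟨?_, ENNReal.ofReal_pos.mpr hr0, fun {y} hy => ?_⟩
    · refine p.le_radius_of_bound (∑' n : ι → ℤ, C * Real.exp (-(ε / 2 * ‖n‖))) fun q => ?_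
      rw [Real.coe_toNNReal r hr0.le]
      calc ‖p q‖ * r ^ q ≤ (∑' n, ‖τ q n‖) * r ^ q := by
            gcongr; exact norm_tsum_le_tsum_norm (hτs q)
        _ = ∑' n, ‖τ q n‖ * r ^ q := tsum_mul_right.symm
        _ ≤ _ := Summable.tsum_le_tsum (hτ q) ((hτs q).mul_right _) hsum
    · have hy' : ‖y‖ < r := by
        rw [Metric.mem_eball, edist_zero_right, ← ofReal_norm,
          ENNReal.ofReal_lt_ofReal_iff hr0] at hy
        exact hy
      have hexp (n) : HasSum (fun q : ℕ => c n * (ℓ n y ^ q / (q.factorial : ℂ)))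
          (c n * Complex.exp (ℓ n y)) := by
        have := NormedSpace.exp_series_hasSum_exp' (𝕂 := ℂ) (ℓ n y)
        rw [← Complex.exp_eq_exp_ℂ] at this
        refine HasSum.mul_left (c n) (this.congr_fun fun q => ?_)
        rw [smul_eq_mul, div_eq_inv_mul]
      have hF : Summable fun z : (ι → ℤ) × ℕ => c z.1 * (ℓ z.1 y ^ z.2 / (z.2.factorial : ℂ)) := by
        refine Summable.of_norm ?_
        have hnorm (n) : HasSum (fun q : ℕ => ‖c n * (ℓ n y ^ q / (q.factorial : ℂ))‖)
            (‖c n‖ * Real.exp ‖ℓ n y‖) := by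
          have := NormedSpace.exp_series_hasSum_exp' (𝕂 := ℝ) ‖ℓ n y‖
          rw [← Real.exp_eq_exp_ℝ] at this
          refine (HasSum.mul_left ‖c n‖ this).congr_fun fun q => ?_
          simp [div_eq_inv_mul]
        rw [summable_prod_of_nonneg fun _ => norm_nonneg _]
        refine ⟨fun n => (hnorm n).summable, ?_⟩
        simp only [(hnorm _).tsum_eq]
        refine Summable.of_nonneg_of_le (fun _ => by positivity) (fun n => ?_) hsum
        calc ‖c n‖ * Real.exp ‖ℓ n y‖
            ≤ (C * Real.exp (-(ε * ‖n‖))) * Real.exp (ε / 2 * ‖n‖) := by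
              refine mul_le_mul (hcn n) (Real.exp_le_exp.mpr ?_) (by positivity) (by positivity)
              calc ‖ℓ n y‖ ≤ (M * ‖n‖) * r :=
                    (ℓ n).le_of_opNorm_le_of_le (hℓ n) hy'.le
                _ = (M * r) * ‖n‖ := by ring
                _ ≤ ε / 2 * ‖n‖ := by gcongr
          _ = C * Real.exp (-(ε / 2 * ‖n‖)) := by
            rw [mul_assoc, ← Real.exp_add]; congr 2; ring
      have hval : ∑' z : (ι → ℤ) × ℕ, c z.1 * (ℓ z.1 y ^ z.2 / (z.2.factorial : ℂ)) =
          ∑' n, a n * Complex.exp (ℓ n (x₀ + y)) := by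
        rw [hF.tsum_prod' fun n => (hexp n).summable]
        refine tsum_congr fun n => ?_
        rw [(hexp n).tsum_eq, map_add, Complex.exp_add, hc, mul_assoc]
      have hsw : HasSum (fun z : ℕ × (ι → ℤ) => c z.2 * (ℓ z.2 y ^ z.1 / (z.1.factorial : ℂ)))
          (∑' n, a n * Complex.exp (ℓ n (x₀ + y))) := by
        rw [← hval]
        exact (Equiv.prodComm ℕ (ι → ℤ)).hasSum_iff.mpr hF.hasSum
      refine hsw.prod_fiberwise fun q => ?_
      have h2 := (hτs q).of_norm.hasSum.mapL
        (ContinuousMultilinearMap.apply ℝ (fun _ : Fin q => E) ℂ fun _ => y)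
      refine h2.congr_fun fun n => ?_
      exact (hτ_apply q n y).symm
  exact hp.analyticAt

/-- Cauchy-type bounds for the directional derivatives of an analytic function on a compact set. -/
theorem exists_iteratedFDeriv_bound {f : E → ℂ} (hf : AnalyticOnNhd ℝ f Set.univ) {K : Set E}
    (hK : IsCompact K) : ∃ C r : ℝ, 0 ≤ C ∧ 0 < r ∧ ∀ x ∈ K, ∀ (q : ℕ) (w : E),
      ‖iteratedFDeriv ℝ q f x fun _ => w‖ ≤ C * q.factorial * (‖w‖ / r) ^ q := by
  -- Such bounds pass to subsets and to finite unions, so compactness reduces the claim to a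
  -- neighbourhood of each point.
  refine hK.induction_on (p := fun K => ∃ C r : ℝ, 0 ≤ C ∧ 0 < r ∧ ∀ x ∈ K, ∀ (q : ℕ) (w : E),
      ‖iteratedFDeriv ℝ q f x fun _ => w‖ ≤ C * q.factorial * (‖w‖ / r) ^ q)
    ⟨0, 1, le_rfl, one_pos, fun x hx => hx.elim⟩ ?_ ?_ ?_
  · intro s t hst ht
    obtain ⟨C, r, hC, hr, h⟩ := ht
    exact ⟨C, r, hC, hr, fun x hx => h x (hst hx)⟩
  · intro s t hs ht
    obtain ⟨C, r, hC, hr, h⟩ := hs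
    obtain ⟨C', r', hC', hr', h'⟩ := ht
    refine ⟨max C C', min r r', le_max_of_le_left hC, lt_min hr hr', fun x hx q w => ?_⟩
    rcases hx with hx | hx
    · refine (h x hx q w).trans ?_
      gcongr
      · exact le_max_left _ _
      · exact min_le_left _ _
    · refine (h' x hx q w).trans ?_
      gcongr
      · exact le_max_right _ _
      · exact min_le_right _ _
  · intro x₀ _
    obtain ⟨p, R, hp⟩ := hf x₀ (mem_univ x₀)
    obtain ⟨ρ, hρ0, hρR⟩ : ∃ ρ : NNReal, 0 < ρ ∧ (ρ : ENNReal) < R := by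
      obtain ⟨ρ, h1, h2⟩ := ENNReal.lt_iff_exists_nnreal_btwn.mp hp.r_pos
      exact ⟨ρ, by exact_mod_cast h1, h2⟩
    -- Half for recentring the power series at `y`, half for its coefficients there: `r + r` stays
    -- inside the radius of convergence, so the single double series `S` bounds all recentred
    -- coefficients uniformly.
    set r : NNReal := ρ / 2
    have hr0 : 0 < r := by positivity
    have hrr : (r + r : ENNReal) = ρ := by
      rw [← ENNReal.coe_add]; congr 1; exact add_halves ρ
    have hrad : (r + r : ENNReal) < p.radius := hrr ▸ hρR.trans_le hp.r_le
    have hS := p.changeOriginSeries_summable_aux₁ hrad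
    set S : NNReal := ∑' s : (Σ k l : ℕ, { s : Finset (Fin (k + l)) // s.card = l }),
      ‖p (s.1 + s.2.1)‖₊ * r ^ s.2.1 * r ^ s.1
    have hbound (y : E) (hy : ‖y‖₊ ≤ r) (q : ℕ) : ‖p.changeOrigin y q‖₊ * r ^ q ≤ S := by
      have hyr : (‖y‖₊ : ENNReal) < p.radius :=
        lt_of_le_of_lt (by exact_mod_cast hy) (lt_of_le_of_lt le_self_add hrad)
      have h1 := p.nnnorm_changeOrigin_le q hyr
      have hrr' : (r : ENNReal) < p.radius := lt_of_le_of_lt le_self_add hrad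
      calc ‖p.changeOrigin y q‖₊ * r ^ q
          ≤ (∑' s : Σ l : ℕ, { s : Finset (Fin (q + l)) // s.card = l },
              ‖p (q + s.1)‖₊ * r ^ s.1) * r ^ q := by
            gcongr
            refine h1.trans ?_
            refine Summable.tsum_le_tsum (fun s => by gcongr)
              (p.changeOriginSeries_summable_aux₂ hyr q)
              (p.changeOriginSeries_summable_aux₂ hrr' q)
        _ = ∑' s : Σ l : ℕ, { s : Finset (Fin (q + l)) // s.card = l },
              ‖p (q + s.1)‖₊ * r ^ s.1 * r ^ q := (NNReal.tsum_mul_right _ _).symm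
        _ ≤ S := by
            have h2 := NNReal.summable_sigma.1 hS
            have h3 := h2.2.hasSum
            rw [← hS.tsum_sigma' (fun k => h2.1 k)] at h3
            exact le_hasSum h3 q fun _ _ => zero_le
    refine ⟨Metric.ball x₀ r, mem_nhdsWithin_of_mem_nhds (Metric.ball_mem_nhds _ hr0), S, r,
      S.2, hr0, fun x hx q w => ?_⟩
    set y := x - x₀
    have hxy : x = x₀ + y := by simp [y]
    have hy : ‖y‖₊ < r := by
      rw [mem_ball_iff_norm] at hx
      exact_mod_cast hx
    have hyR : (‖y‖₊ : ENNReal) < R := by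
      refine lt_of_lt_of_le ?_ (hrr ▸ hρR.le)
      exact lt_of_lt_of_le (by exact_mod_cast hy) le_self_add
    have h1 := (hp.changeOrigin hyR).factorial_smul w q
    rw [hxy, ← h1, nsmul_eq_mul, norm_mul, Complex.norm_natCast]
    have h2 := (p.changeOrigin y q).le_opNorm fun _ => w
    simp only [Finset.prod_const, Finset.card_univ, Fintype.card_fin] at h2
    have h3 : ‖p.changeOrigin y q‖ * (r : ℝ) ^ q ≤ S := by exact_mod_cast hbound y hy.le q
    have hr0' : (0 : ℝ) < (r : ℝ) ^ q := by positivity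
    calc (q.factorial : ℝ) * ‖p.changeOrigin y q fun _ => w‖
        ≤ q.factorial * ((S / (r : ℝ) ^ q) * ‖w‖ ^ q) := by
          gcongr
          refine h2.trans ?_
          gcongr
          rwa [le_div_iff₀ hr0']
      _ = S * q.factorial * (‖w‖ / r) ^ q := by rw [div_pow]; ring

end Analytic

/-! ### The Brillouin torus as a standard torus -/

section Transfer

variable {d : ℕ} (γ : Module.Basis (Fin d) ℝ (Space d))

/-- The coordinates `k · γ_j / 2π` as a linear map. -/
def coordsLin : Space d →ₗ[ℝ] (Fin d → ℝ) where
  toFun k j := ⟪k, γ j⟫_ℝ / (2 * Real.pi)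
  map_add' x y := by ext j; simp [inner_add_left, add_div]
  map_smul' c x := by ext j; simp [inner_smul_left, mul_div_assoc]

theorem coordsLin_injective : Function.Injective (coordsLin γ) := by
  rw [injective_iff_map_eq_zero]
  intro k hk
  refine InnerProductSpace.ext_inner_left_basis γ fun j => ?_
  have h := congrFun hk j
  simp only [coordsLin, LinearMap.coe_mk, AddHom.coe_mk, Pi.zero_apply] at h
  rw [real_inner_comm, inner_zero_right]
  exact (div_eq_zero_iff.mp h).resolve_right (by positivity)

/-- The coordinates with respect to the dual basis, `k ↦ (k · γ_j / 2π)_j`. -/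
def coords : Space d ≃L[ℝ] (Fin d → ℝ) :=
  (LinearMap.linearEquivOfInjective (coordsLin γ) (coordsLin_injective γ)
    (by simp)).toContinuousLinearEquiv

theorem coords_apply (k : Space d) (j : Fin d) : coords γ k j = ⟪k, γ j⟫_ℝ / (2 * Real.pi) := rfl

theorem inner_coords_symm (x : Fin d → ℝ) (j : Fin d) :
    ⟪(coords γ).symm x, γ j⟫_ℝ = 2 * Real.pi * x j := by
  have h := coords_apply γ ((coords γ).symm x) j
  rw [ContinuousLinearEquiv.apply_symm_apply] at h
  rw [h]
  field_simp

theorem dualCell_eq : dualCell γ = coords γ ⁻¹' Set.Icc (fun _ => -(1 / 2)) (fun _ => 1 / 2) := by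
  ext k
  simp only [dualCell, mem_ofPred_eq, mem_preimage, mem_Icc, Pi.le_def, coords_apply]
  exact forall_and

theorem isCompact_dualCell : IsCompact (dualCell γ) := by
  rw [dualCell_eq]
  exact (coords γ).toHomeomorph.isCompact_preimage.mpr isCompact_Icc

theorem mem_dualLattice_of_forall {k : Space d}
    (h : ∀ j, ∃ n : ℤ, ⟪k, γ j⟫_ℝ = 2 * Real.pi * n) : k ∈ dualLattice γ := by
  intro g hg
  induction hg using AddSubgroup.closure_induction with
  | mem x hx => obtain ⟨j, rfl⟩ := hx; exact h j
  | zero => exact ⟨0, by simp⟩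
  | add x y _ _ hx hy =>
    obtain ⟨a, ha⟩ := hx
    obtain ⟨b, hb⟩ := hy
    exact ⟨a + b, by rw [inner_add_right, ha, hb]; push_cast; ring⟩
  | neg x _ hx =>
    obtain ⟨a, ha⟩ := hx
    exact ⟨-a, by rw [inner_neg_right, ha]; push_cast; ring⟩

/-- The covering map onto the standard torus. -/
def toTorus (k : Space d) : UnitAddTorus (Fin d) := fun j => (coords γ k j : UnitAddCircle)

theorem toTorus_add (k v : Space d) : toTorus γ (k + v) = toTorus γ k + toTorus γ v := by
  ext j
  simp [toTorus]

theorem sub_mem_dualLattice {k k' : Space d} (h : toTorus γ k = toTorus γ k') :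
    k - k' ∈ dualLattice γ := by
  refine mem_dualLattice_of_forall γ fun j => ?_
  have hj : ((coords γ k j - coords γ k' j : ℝ) : UnitAddCircle) = 0 := by
    rw [AddCircle.coe_sub, sub_eq_zero]
    exact congrFun h j
  obtain ⟨n, hn⟩ := (AddCircle.coe_eq_zero_iff (1 : ℝ)).mp hj
  refine ⟨n, ?_⟩
  rw [coords_apply, coords_apply, ← sub_div, ← inner_sub_left] at hn
  simp only [zsmul_eq_mul, mul_one] at hn
  rw [hn]
  field_simp

/-- The section of the covering map with values in the centered cell. -/
def cellSection (t : UnitAddTorus (Fin d)) : Space d :=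
  (coords γ).symm (measurableEquivPiIoc (fun _ => -(1 / 2)) t).1

theorem coords_cellSection (t : UnitAddTorus (Fin d)) (j : Fin d) :
    coords γ (cellSection γ t) j = (AddCircle.equivIoc 1 (-(1 / 2) : ℝ) (t j)).1 := by
  simp [cellSection]

theorem toTorus_cellSection (t : UnitAddTorus (Fin d)) : toTorus γ (cellSection γ t) = t := by
  ext j
  rw [toTorus, coords_cellSection]
  exact AddCircle.coe_equivIoc

theorem cellSection_mem (t : UnitAddTorus (Fin d)) : cellSection γ t ∈ dualCell γ := by
  intro j
  rw [← coords_apply, coords_cellSection]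
  have := (AddCircle.equivIoc 1 (-(1 / 2) : ℝ) (t j)).2
  exact ⟨this.1.le, this.2.trans (by norm_num)⟩

theorem measurableEmbedding_cellSection : MeasurableEmbedding (cellSection γ) := by
  refine (coords γ).symm.toHomeomorph.measurableEmbedding.comp
    ((MeasurableEmbedding.subtype_coe ?_).comp (measurableEquivPiIoc _).measurableEmbedding)
  exact MeasurableSet.univ_pi' fun i => measurableSet_Ioc

/-- The constant compares two Haar measures on `ℝ^d`: the image of the Lebesgue measure in dual
coordinates and the Euclidean one. Only `c ≠ 0` matters, since it scales every term of the equations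
alike. -/
theorem exists_measurePreserving_cellSection : ∃ c : NNReal, c ≠ 0 ∧
    MeasurePreserving (cellSection γ) volume (c • volume.restrict (dualCell γ)) := by
  set μ' : Measure (Space d) := Measure.map (coords γ).symm volume with hμ'
  have hH : μ'.IsAddHaarMeasure := ContinuousLinearEquiv.isAddHaarMeasure_map _ _
  refine ⟨Measure.addHaarScalarFactor μ' volume,
    (Measure.addHaarScalarFactor_pos_of_isAddHaarMeasure μ' volume).ne', ?_⟩
  have hμ : μ' = Measure.addHaarScalarFactor μ' volume • (volume : Measure (Space d)) :=
    Measure.isAddLeftInvariant_eq_smul μ' volume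
  rw [← Measure.restrict_smul, ← hμ]
  have h1 := measurePreserving_equivPiIoc (d := Fin d) (fun _ => (-(1 / 2) : ℝ))
  have h2 : MeasurePreserving Subtype.val
      (Measure.comap (Subtype.val : {x : Fin d → ℝ // ∀ i, x i ∈ Ioc (-(1 / 2) : ℝ) (-(1 / 2) + 1)} → _)
        volume) (volume.restrict {x : Fin d → ℝ | ∀ i, x i ∈ Ioc (-(1 / 2) : ℝ) (-(1 / 2) + 1)}) :=
    measurePreserving_subtype_coe (MeasurableSet.univ_pi' fun i => measurableSet_Ioc)
  have h3 : MeasurePreserving (coords γ).symm (volume : Measure (Fin d → ℝ)) μ' :=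
    ⟨(coords γ).symm.continuous.measurable, rfl⟩
  have h4 := h3.restrict_preimage (isCompact_dualCell γ).measurableSet
  -- The section uses the half-open box and the cell is closed; they differ by a null set.
  have h5 : (volume : Measure (Fin d → ℝ)).restrict ((coords γ).symm ⁻¹' dualCell γ) =
      volume.restrict {x : Fin d → ℝ | ∀ i, x i ∈ Ioc (-(1 / 2) : ℝ) (-(1 / 2) + 1)} := by
    refine Measure.restrict_congr_set ?_
    have h6 := Measure.univ_pi_Ioc_ae_eq_Icc (μ := fun _ : Fin d => (volume : Measure ℝ))
      (f := fun _ => -(1 / 2)) (g := fun _ => 1 / 2)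
    rw [← volume_pi] at h6
    have h7 : (coords γ).symm ⁻¹' dualCell γ =
        (Set.Icc (fun _ => -(1 / 2)) (fun _ => 1 / 2) : Set (Fin d → ℝ)) := by
      rw [dualCell_eq, ← Set.preimage_comp]
      simp
    have h8 : {x : Fin d → ℝ | ∀ i, x i ∈ Ioc (-(1 / 2) : ℝ) (-(1 / 2) + 1)} =
        Set.univ.pi fun _ => Set.Ioc (-(1 / 2) : ℝ) (1 / 2) := by
      ext x
      simp only [mem_ofPred_eq, Set.mem_univ_pi]
      norm_num
    rw [h7, h8]
    exact h6.symm
  rw [h5] at h4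
  exact h4.comp (h2.comp h1)

theorem memLp_comp_cellSection {F : Type*} [NormedAddCommGroup F] {f : Space d → F} {p : ENNReal}
    (hf : MemLp f p (volume.restrict (dualCell γ))) :
    MemLp (fun t => f (cellSection γ t)) p volume := by
  obtain ⟨c, -, hc⟩ := exists_measurePreserving_cellSection γ
  exact (hf.smul_measure (c := (c : ENNReal)) ENNReal.coe_ne_top).comp_measurePreserving hc

theorem exists_integral_cellSection : ∃ c : ℝ, c ≠ 0 ∧ ∀ f : Space d → ℂ,
    ∫ t, f (cellSection γ t) = c * ∫ k in dualCell γ, f k := by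
  obtain ⟨c, hc0, hc⟩ := exists_measurePreserving_cellSection γ
  refine ⟨c, by exact_mod_cast hc0, fun f => ?_⟩
  rw [hc.integral_comp (measurableEmbedding_cellSection γ), integral_smul_nnreal_measure]
  exact Complex.real_smul

theorem ae_cellSection_iff {p : Space d → Prop} :
    (∀ᵐ t, p (cellSection γ t)) ↔ ∀ᵐ k ∂volume.restrict (dualCell γ), p k := by
  obtain ⟨c, hc0, hc⟩ := exists_measurePreserving_cellSection γ
  rw [← (measurableEmbedding_cellSection γ).ae_map_iff, hc.map_eq]
  exact Measure.ae_ennreal_smul_measure_iff (c := (c : ENNReal)) (by exact_mod_cast hc0)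

variable {γ}

theorem IsPeriodic.apply_eq {F : Type*} {f : Space d → F} (hf : IsPeriodic γ f) {k k' : Space d}
    (h : toTorus γ k = toTorus γ k') : f k = f k' := by
  have := hf k' _ (sub_mem_dualLattice γ h)
  rwa [add_sub_cancel] at this

theorem IsPeriodic.apply_cellSection_add {F : Type*} {f : Space d → F} (hf : IsPeriodic γ f)
    (t : UnitAddTorus (Fin d)) (v : Space d) :
    f (cellSection γ t + v) = f (cellSection γ (t + toTorus γ v)) := by
  refine hf.apply_eq ?_
  rw [toTorus_add, toTorus_cellSection, toTorus_cellSection]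

theorem IsPeriodic.apply_cellSection_toTorus {F : Type*} {f : Space d → F} (hf : IsPeriodic γ f)
    (k : Space d) : f (cellSection γ (toTorus γ k)) = f k :=
  hf.apply_eq (toTorus_cellSection γ _)

theorem IsPeriodic.exists_bound {F : Type*} [NormedAddCommGroup F] {f : Space d → F}
    (hf : IsPeriodic γ f) (hc : Continuous f) : ∃ C, ∀ k, ‖f k‖ ≤ C := by
  obtain ⟨C, hC⟩ := (isCompact_dualCell γ).exists_bound_of_continuousOn hc.continuousOn
  exact ⟨C, fun k => hf.apply_cellSection_toTorus k ▸ hC _ (cellSection_mem γ _)⟩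

theorem aestronglyMeasurable_comp_cellSection {F : Type*} [NormedAddCommGroup F] {f : Space d → F}
    (hc : Continuous f) : AEStronglyMeasurable (fun t => f (cellSection γ t)) volume :=
  hc.aestronglyMeasurable.comp_measurable (measurableEmbedding_cellSection γ).measurable

theorem IsPeriodic.memLp_top {f : Space d → ℂ} (hf : IsPeriodic γ f) (hc : Continuous f) :
    MemLp (fun t => f (cellSection γ t)) ⊤ volume := by
  obtain ⟨C, hC⟩ := hf.exists_bound hc
  exact memLp_top_of_bound (aestronglyMeasurable_comp_cellSection hc) C
    (Eventually.of_forall fun t => hC _)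

/-- Periodic functions which agree almost everywhere on the cell agree almost everywhere. -/
theorem IsPeriodic.ae_eq {F : Type*} {f g : Space d → F} (hf : IsPeriodic γ f)
    (hg : IsPeriodic γ g) (h : ∀ᵐ t, f (cellSection γ t) = g (cellSection γ t)) :
    f =ᵐ[volume] g := by
  rw [ae_cellSection_iff γ (p := fun k => f k = g k),
    ae_restrict_iff' (isCompact_dualCell γ).measurableSet] at h
  -- Countably many lattice translates of the cell cover the space, so the exceptional set is a
  -- countable union of null sets.
  have hall : ∀ᵐ k : Space d, ∀ n : Fin d → ℤ,
      k + (coords γ).symm (fun j => (n j : ℝ)) ∈ dualCell γ →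
        f (k + (coords γ).symm (fun j => (n j : ℝ))) = g (k + (coords γ).symm fun j => (n j : ℝ)) := by
    rw [ae_all_iff]
    intro n
    exact (measurePreserving_add_right volume
      ((coords γ).symm fun j => (n j : ℝ))).quasiMeasurePreserving.ae h
  filter_upwards [hall] with k hk
  set k' := cellSection γ (toTorus γ k) with hk'
  have hl : k' - k ∈ dualLattice γ := sub_mem_dualLattice γ (toTorus_cellSection γ _)
  choose n hn using fun j => hl (γ j) (AddSubgroup.subset_closure (mem_range_self j))
  have hk2 : k + (coords γ).symm (fun j => (n j : ℝ)) = k' := by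
    have : (coords γ).symm (fun j => (n j : ℝ)) = k' - k := by
      rw [ContinuousLinearEquiv.symm_apply_eq]
      ext j
      rw [coords_apply, hn j]
      field_simp
    rw [this]; abel
  have h1 := hk n
  rw [hk2] at h1
  rw [← hf.apply_cellSection_toTorus k, ← hg.apply_cellSection_toTorus k]
  exact h1 (cellSection_mem γ _)

/-! ### Characters, symbols of derivatives, and decay of coefficients of analytic periodic
functions. -/

variable (γ)

/-- The lattice vector `∑ n_j γ_j`. -/
def freq (n : Fin d → ℤ) : Space d := ∑ j, (n j : ℝ) • γ j

theorem freq_add (m n : Fin d → ℤ) : freq γ (m + n) = freq γ m + freq γ n := by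
  simp [freq, add_smul, Finset.sum_add_distrib]

theorem repr_freq (n : Fin d → ℤ) (j : Fin d) : γ.equivFun (freq γ n) j = n j := by
  simp [freq, Finsupp.single_apply]

theorem freq_injective : Function.Injective (freq γ) := by
  intro m n h
  ext j
  have := repr_freq γ m j
  rw [h, repr_freq] at this
  exact_mod_cast this.symm

theorem freq_mem (n : Fin d → ℤ) : freq γ n ∈ lattice γ := by
  refine AddSubgroup.sum_mem _ fun j _ => ?_
  rw [Int.cast_smul_eq_zsmul]
  exact AddSubgroup.zsmul_mem _ (AddSubgroup.subset_closure (mem_range_self j)) _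

/-- The Fourier multiplier of the derivative in direction `w`. -/
def symbol (w : Space d) : (Fin d → ℤ) →+ ℂ where
  toFun n := Complex.I * (⟪freq γ n, w⟫_ℝ : ℝ)
  map_zero' := by simp [freq]
  map_add' m n := by rw [freq_add, inner_add_left]; push_cast; ring

theorem symbol_apply (w : Space d) (n : Fin d → ℤ) :
    symbol γ w n = Complex.I * (⟪freq γ n, w⟫_ℝ : ℝ) := rfl

theorem conj_symbol (w : Space d) (n : Fin d → ℤ) : conj (symbol γ w n) = -symbol γ w n := by
  simp [symbol_apply]

/-- The character `k ↦ e^{i (∑ n_j γ_j) · k}`. -/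
def char (n : Fin d → ℤ) (k : Space d) : ℂ := Complex.exp (Complex.I * (⟪freq γ n, k⟫_ℝ : ℝ))

theorem char_eq_mFourier (n : Fin d → ℤ) (k : Space d) : char γ n k = mFourier n (toTorus γ k) := by
  simp only [char, mFourier, ContinuousMap.coe_mk, toTorus, fourier_coe_apply]
  rw [← Complex.exp_sum]
  congr 1
  rw [freq, sum_inner, Complex.ofReal_sum, Finset.mul_sum]
  refine Finset.sum_congr rfl fun j _ => ?_
  rw [coords_apply, inner_smul_left, real_inner_comm]
  have : (Real.pi : ℂ) ≠ 0 := by exact_mod_cast Real.pi_ne_zero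
  push_cast
  simp
  field_simp

theorem char_cellSection (n : Fin d → ℤ) (t : UnitAddTorus (Fin d)) :
    char γ n (cellSection γ t) = mFourier n t := by
  rw [char_eq_mFourier, toTorus_cellSection]

theorem conj_char (n : Fin d → ℤ) (k : Space d) : conj (char γ n k) = char γ (-n) k := by
  rw [char_eq_mFourier, char_eq_mFourier, mFourier_neg]

theorem isPeriodic_char (n : Fin d → ℤ) : IsPeriodic γ (char γ n) := by
  intro k l hl
  obtain ⟨N, hN⟩ := hl _ (freq_mem γ n)
  rw [char, char, inner_add_right, real_inner_comm l, hN, Complex.exp_eq_exp_iff_exists_int]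
  exact ⟨N, by push_cast; ring⟩

theorem contDiff_char (n : Fin d → ℤ) : ContDiff ℝ ∞ (char γ n) := by
  unfold char
  have h : ContDiff ℝ ∞ fun k : Space d => ((⟪freq γ n, k⟫_ℝ : ℝ) : ℂ) :=
    Complex.ofRealCLM.contDiff.comp (contDiff_const.inner ℝ contDiff_id)
  exact (contDiff_const.mul h).cexp

theorem hasDerivAt_char_line (n : Fin d → ℤ) (k w : Space d) (s : ℝ) :
    HasDerivAt (fun s : ℝ => char γ n (k + s • w)) (symbol γ w n * char γ n (k + s • w)) s := by
  unfold char
  have h1 : HasDerivAt (fun s : ℝ => ⟪freq γ n, k + s • w⟫_ℝ) ⟪freq γ n, w⟫_ℝ s := by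
    simp only [inner_add_right, inner_smul_right]
    simpa using ((hasDerivAt_id s).mul_const ⟪freq γ n, w⟫_ℝ).const_add ⟪freq γ n, k⟫_ℝ
  have h2 := (h1.ofReal_comp.const_mul Complex.I).cexp
  rw [symbol_apply, mul_comm]
  exact h2

theorem fderiv_char (n : Fin d → ℤ) (k w : Space d) :
    fderiv ℝ (char γ n) k w = symbol γ w n * char γ n k := by
  have h1 : DifferentiableAt ℝ (char γ n) k :=
    ((contDiff_char γ n).differentiable (by simp)).differentiableAt
  have h2 := hasDerivAt_char_line γ n k w 0
  have h3 : HasDerivAt (fun s : ℝ => k + s • w) w 0 := by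
    simpa using ((hasDerivAt_id (0 : ℝ)).smul_const w).const_add k
  have h4 : HasFDerivAt (char γ n) (fderiv ℝ (char γ n) k) (k + (0 : ℝ) • w) := by
    simpa using h1.hasFDerivAt
  have h5 := h4.comp_hasDerivAt (0 : ℝ) h3
  simpa using h5.unique h2

variable {γ}

theorem IsPeriodic.periodic_fderiv {f : Space d → ℂ} (hf : IsPeriodic γ f) : IsPeriodic γ (fderiv ℝ f) := by
  intro k l hl
  rw [← fderiv_comp_add_right]
  congr 1
  ext x
  exact hf x l hl

/-- The Fourier multiplier of a directional derivative of a periodic function. -/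
theorem IsPeriodic.hasFourierDeriv {f : Space d → ℂ} (hf : IsPeriodic γ f) (h1 : ContDiff ℝ 1 f)
    (w : Space d) : HasFourierDeriv (symbol γ w) (fun t => f (cellSection γ t))
      fun t => fderiv ℝ f (cellSection γ t) w := by
  intro n
  have hc' : Continuous fun k => fderiv ℝ f k w :=
    (h1.continuous_fderiv (by simp)).clm_apply continuous_const
  have hp' : IsPeriodic γ fun k => fderiv ℝ f k w := fun k l hl => by
    simp only [hf.periodic_fderiv k l hl]
  obtain ⟨C, hC⟩ := hp'.exists_bound hc'
  obtain ⟨C₀, hC₀⟩ := hf.exists_bound h1.continuous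
  have hline (k : Space d) (s : ℝ) : HasDerivAt (fun s : ℝ => f (k + s • w))
      (fderiv ℝ f (k + s • w) w) s := by
    have h3 : HasDerivAt (fun s : ℝ => k + s • w) w s := by
      simpa using ((hasDerivAt_id s).smul_const w).const_add k
    exact ((h1.differentiable (by simp)).differentiableAt.hasFDerivAt).comp_hasDerivAt s h3
  have hmeas (s : ℝ) : AEStronglyMeasurable
      (fun t => mFourier (-n) t * f (cellSection γ t + s • w)) volume :=
    (measurable_mFourier _).mul (aestronglyMeasurable_comp_cellSection (γ := γ)
      (f := fun k => f (k + s • w)) (h1.continuous.comp (continuous_id.add continuous_const)))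
  -- The `n`-th coefficient of the translate `f (· + s • w)` is differentiated at `s = 0` in two
  -- ways: here under the integral sign, and in `hval` through translation invariance, where the
  -- translate only contributes a character. This replaces integration by parts on the cell.
  have hint := (hasDerivAt_integral_of_dominated_loc_of_deriv_le
    (μ := (volume : Measure (UnitAddTorus (Fin d)))) (x₀ := (0 : ℝ)) (s := Set.univ)
    (F := fun (s : ℝ) t => mFourier (-n) t * f (cellSection γ t + s • w))
    (F' := fun (s : ℝ) t => mFourier (-n) t * fderiv ℝ f (cellSection γ t + s • w) w)
    (bound := fun _ => C) univ_mem (Eventually.of_forall hmeas)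
    (Integrable.of_bound (hmeas 0) C₀ (Eventually.of_forall fun t => by
      simpa [norm_mFourier_apply] using hC₀ _))
    ((measurable_mFourier _).mul (aestronglyMeasurable_comp_cellSection (γ := γ)
      (f := fun k => fderiv ℝ f (k + (0 : ℝ) • w) w)
      (hc'.comp (continuous_id.add continuous_const))))
    (Eventually.of_forall fun t s _ => by simpa [norm_mFourier_apply] using hC _)
    (integrable_const C)
    (Eventually.of_forall fun t s _ => (hline _ s).const_mul _)).2
  have hval (s : ℝ) : ∫ t, mFourier (-n) t * f (cellSection γ t + s • w) =
      char γ n (0 + s • w) * mFourierCoeff (fun t => f (cellSection γ t)) n := by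
    have hshift := integral_add_right_eq_self (μ := (volume : Measure (UnitAddTorus (Fin d))))
      (fun t => mFourier (-n) (t - toTorus γ (s • w)) * f (cellSection γ t)) (toTorus γ (s • w))
    simp only [add_sub_cancel_right] at hshift
    simp only [hf.apply_cellSection_add]
    rw [hshift, coeff_def, zero_add, char_eq_mFourier, ← integral_const_mul]
    congr 1
    ext t
    have : mFourier (-n) (t - toTorus γ (s • w)) =
        mFourier n (toTorus γ (s • w)) * mFourier (-n) t := by
      simp only [mFourier, ContinuousMap.coe_mk, ← Finset.prod_mul_distrib]
      refine Finset.prod_congr rfl fun j _ => ?_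
      rw [fourier_apply, fourier_apply, fourier_apply, ← Circle.coe_mul, ← AddCircle.toCircle_add]
      congr 2
      simp only [Pi.sub_apply, Pi.neg_apply, smul_sub, neg_smul]
      abel
    rw [this, mul_assoc]
  simp only [hval] at hint
  have h2 := ((hasDerivAt_char_line γ n 0 w 0).mul_const
    (mFourierCoeff (fun t => f (cellSection γ t)) n)).unique hint
  simp only [zero_smul, add_zero] at h2
  rw [coeff_def, ← h2]
  simp [char]

/-- The Fourier coefficients of a periodic real-analytic function decay exponentially. -/
theorem IsPeriodic.expDecay {f : Space d → ℂ} (hf : IsPeriodic γ f)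
    (ha : AnalyticOnNhd ℝ f Set.univ) :
    ExpDecay fun n => mFourierCoeff (fun t => f (cellSection γ t)) n := by
  have hcd : ContDiff ℝ ∞ f := (contDiff_omega_iff_analyticOnNhd.mpr ha).of_le le_top
  obtain ⟨C, r, hC, hr, hb⟩ := exists_iteratedFDeriv_bound ha (isCompact_dualCell γ)
  have hiter (w : Space d) (q : ℕ) : IsPeriodic γ (fun k => iteratedFDeriv ℝ q f k fun _ => w) ∧
      ∀ n, mFourierCoeff (fun t => iteratedFDeriv ℝ q f (cellSection γ t) fun _ => w) n =
        symbol γ w n ^ q * mFourierCoeff (fun t => f (cellSection γ t)) n := by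
    have hper (q : ℕ) : IsPeriodic γ (fun k => iteratedFDeriv ℝ q f k fun _ => w) := by
      intro k l hl
      simp only
      rw [← iteratedFDeriv_comp_add_right]
      congr 2
      ext x
      exact hf x l hl
    refine ⟨hper q, ?_⟩
    induction q with
    | zero => intro n; simp
    | succ q ih =>
      intro n
      have hdq : ContDiff ℝ 1 (iteratedFDeriv ℝ q f) :=
        hcd.iteratedFDeriv_right (m := 1) (by exact_mod_cast le_top)
      have hd1 : ContDiff ℝ 1 fun k => iteratedFDeriv ℝ q f k fun _ => w :=
        (ContinuousMultilinearMap.apply ℝ (fun _ : Fin q => Space d) ℂ fun _ => w).contDiff.comp hdq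
      have h1 := (hper q).hasFourierDeriv hd1 w n
      rw [ih n, ← mul_assoc, ← pow_succ'] at h1
      rw [← h1]
      congr 1
      ext t
      rw [iteratedFDeriv_succ_apply_left]
      have h2 := (ContinuousMultilinearMap.apply ℝ (fun _ : Fin q => Space d) ℂ
        fun _ => w).hasFDerivAt.comp (cellSection γ t)
          ((hdq.differentiable (by simp)).differentiableAt (x := cellSection γ t)).hasFDerivAt
      have h3 : HasFDerivAt (fun k => iteratedFDeriv ℝ q f k fun _ => w) _ (cellSection γ t) := h2
      rw [h3.fderiv]
      rfl
  -- Derivatives are taken along the dual basis vectors, for which the symbol has modulus `2π |n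
  -- l|`.
  set w : Fin d → Space d := fun l => (coords γ).symm (Pi.single l 1) with hw
  have hsym (l : Fin d) (n : Fin d → ℤ) : ‖symbol γ (w l) n‖ = 2 * Real.pi * |(n l : ℝ)| := by
    have : ⟪freq γ n, w l⟫_ℝ = 2 * Real.pi * n l := by
      have h (j : Fin d) : ⟪γ j, w l⟫_ℝ = 2 * Real.pi * (Pi.single l 1 : Fin d → ℝ) j := by
        rw [real_inner_comm, hw, inner_coords_symm]
      rw [freq, sum_inner]
      simp only [inner_smul_left, h]
      simp [Pi.single_apply]
      ring
    rw [symbol_apply, this, norm_mul, Complex.norm_I, one_mul, Complex.norm_real,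
      Real.norm_eq_abs, abs_mul, abs_of_pos Real.two_pi_pos]
  -- `ρ` exceeds every `‖w l‖ / r`. With `ε = π / ρ` the Cauchy bounds lose a factor `2 ^ q`, so
  -- summing over `q` yields the exponential series on the left and a geometric series on the right.
  set ρ : ℝ := (∑ l, ‖w l‖) / r + 1 with hρ
  have hρ0 : 0 < ρ := by positivity
  set ε : ℝ := Real.pi / ρ with hε
  have hε0 : 0 < ε := by positivity
  have key (n : Fin d → ℤ) (l : Fin d) (q : ℕ) :
      ‖mFourierCoeff (fun t => f (cellSection γ t)) n‖ *
        ((ε * |(n l : ℝ)|) ^ q / q.factorial) ≤ C * (1 / 2) ^ q := by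
    have h1 := norm_coeff_le (C := C * q.factorial * (‖w l‖ / r) ^ q)
      (f := fun t => iteratedFDeriv ℝ q f (cellSection γ t) fun _ => w l)
      (Eventually.of_forall fun t => hb _ (cellSection_mem γ t) q (w l)) n
    rw [(hiter (w l) q).2 n, norm_mul, norm_pow, hsym] at h1
    have h2 : ‖w l‖ / r ≤ ρ := by
      have : ‖w l‖ ≤ ∑ l, ‖w l‖ :=
        Finset.single_le_sum (f := fun l => ‖w l‖) (fun _ _ => norm_nonneg _) (Finset.mem_univ l)
      have : ‖w l‖ / r ≤ (∑ l, ‖w l‖) / r := by gcongr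
      linarith
    have h3 : (2 * Real.pi * |(n l : ℝ)|) ^ q *
        ‖mFourierCoeff (fun t => f (cellSection γ t)) n‖ ≤ C * q.factorial * ρ ^ q :=
      h1.trans (by gcongr)
    have hq : (0 : ℝ) < q.factorial := by positivity
    have h4 : ε * |(n l : ℝ)| = (2 * Real.pi * |(n l : ℝ)|) * (1 / (2 * ρ)) := by
      rw [hε]; field_simp
    rw [h4, mul_pow]
    calc _ = ((2 * Real.pi * |(n l : ℝ)|) ^ q *
        ‖mFourierCoeff (fun t => f (cellSection γ t)) n‖) * ((1 / (2 * ρ)) ^ q / q.factorial) := by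
          ring
      _ ≤ (C * q.factorial * ρ ^ q) * ((1 / (2 * ρ)) ^ q / q.factorial) := by gcongr
      _ = C * (1 / 2) ^ q := by
          rw [div_pow, div_pow, mul_pow]; field_simp
  have key2 (n : Fin d → ℤ) (l : Fin d) : ‖mFourierCoeff (fun t => f (cellSection γ t)) n‖ *
      Real.exp (ε * |(n l : ℝ)|) ≤ 2 * C := by
    have h1 := NormedSpace.exp_series_hasSum_exp' (𝕂 := ℝ) (ε * |(n l : ℝ)|)
    rw [← Real.exp_eq_exp_ℝ] at h1
    have h2 := h1.mul_left ‖mFourierCoeff (fun t => f (cellSection γ t)) n‖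
    have h3 := hasSum_geometric_two.mul_left C
    refine (hasSum_le (fun q => ?_) h2 h3).trans (by linarith)
    have := key n l q
    rwa [div_eq_inv_mul] at this
  refine ⟨2 * C, ε, by positivity, hε0, fun n => ?_⟩
  rw [Real.exp_neg, ← div_eq_mul_inv, le_div_iff₀ (Real.exp_pos _)]
  rcases isEmpty_or_nonempty (Fin d) with he | he
  · have hn : ‖n‖ = 0 := by rw [norm_eq_zero]; exact Subsingleton.elim _ _
    rw [hn, mul_zero, Real.exp_zero, mul_one]
    have h1 := norm_coeff_le (C := C) (f := fun t => f (cellSection γ t))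
      (Eventually.of_forall fun t => by simpa using hb _ (cellSection_mem γ t) 0 0) n
    linarith
  · obtain ⟨l, hl⟩ := Finite.exists_max fun l => ‖n l‖
    have hn : ‖n‖ ≤ |(n l : ℝ)| := by
      rw [← Int.norm_eq_abs]
      exact (pi_norm_le_iff_of_nonneg (norm_nonneg _)).mpr hl
    refine le_trans ?_ (key2 n l)
    gcongr

end Transfer

/-! ### Matrix-valued functions on the torus -/

section MatrixFunctions

variable {ι : Type*} [Fintype ι] {m : ℕ}
  {M N M' N' : UnitAddTorus ι → Matrix (Fin m) (Fin m) ℂ} {p q r : ENNReal}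

/-- All entries of `M` are in `L^p`. -/
def EntryLp (p : ENNReal) (M : UnitAddTorus ι → Matrix (Fin m) (Fin m) ℂ) : Prop :=
  ∀ a b, MemLp (fun t => M t a b) p volume

theorem EntryLp.mul (hM : EntryLp p M) (hN : EntryLp q N) [p.HolderTriple q r] :
    EntryLp r fun t => M t * N t := by
  intro a b
  simp only [Matrix.mul_apply]
  exact memLp_finsetSum _ fun c _ => (hN c b).mul (hM a c)

theorem EntryLp.add (hM : EntryLp p M) (hN : EntryLp p N) : EntryLp p fun t => M t + N t :=
  fun a b => (hM a b).add (hN a b)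

theorem EntryLp.sub (hM : EntryLp p M) (hN : EntryLp p N) : EntryLp p fun t => M t - N t :=
  fun a b => (hM a b).sub (hN a b)

theorem EntryLp.neg (hM : EntryLp p M) : EntryLp p fun t => -M t :=
  fun a b => (hM a b).neg

theorem EntryLp.smul (c : ℝ) (hM : EntryLp p M) : EntryLp p fun t => c • M t :=
  fun a b => (hM a b).const_smul c

theorem EntryLp.conjTranspose (hM : EntryLp p M) : EntryLp p fun t => (M t)ᴴ :=
  fun a b => (hM b a).star

theorem EntryLp.const (M₀ : Matrix (Fin m) (Fin m) ℂ) :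
    EntryLp p fun _ : UnitAddTorus ι => M₀ :=
  fun a b => memLp_const (M₀ a b)

theorem EntryLp.mono (hM : EntryLp p M) (h : q ≤ p) : EntryLp q M :=
  fun a b => (hM a b).mono_exponent h

theorem EntryLp.congr (hM : EntryLp p M) (h : ∀ᵐ t, M t = N t) : EntryLp p N :=
  fun a b => (memLp_congr_ae (h.mono fun t ht => by simp only [ht])).mp (hM a b)

theorem EntryLp.integrable (hM : EntryLp 1 M) (a b : Fin m) : Integrable fun t => M t a b :=
  memLp_one_iff_integrable.mp (hM a b)

theorem EntryLp.two_mul_two (hM : EntryLp 2 M) (hN : EntryLp 2 N) : EntryLp 1 fun t => M t * N t :=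
  hM.mul hN

theorem EntryLp.top_mul (hM : EntryLp ⊤ M) (hN : EntryLp p N) : EntryLp p fun t => M t * N t :=
  hM.mul hN

theorem EntryLp.mul_top (hM : EntryLp p M) (hN : EntryLp ⊤ N) : EntryLp p fun t => M t * N t :=
  hM.mul hN

/-- Entrywise `HasFourierDeriv`. -/
def MatDeriv (θ : (ι → ℤ) →+ ℂ) (M N : UnitAddTorus ι → Matrix (Fin m) (Fin m) ℂ) : Prop :=
  ∀ a b, HasFourierDeriv θ (fun t => M t a b) fun t => N t a b

theorem MatDeriv.mul {θ : (ι → ℤ) →+ ℂ} (h : MatDeriv θ M M') (k : MatDeriv θ N N')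
    (hM : EntryLp 2 M) (hN : EntryLp 2 N) (hM' : EntryLp 2 M') (hN' : EntryLp 2 N') :
    MatDeriv θ (fun t => M t * N t) fun t => M' t * N t + M t * N' t := by
  intro a b
  simp only [Matrix.mul_apply, Matrix.add_apply, ← Finset.sum_add_distrib]
  exact HasFourierDeriv.sum _
    (fun c _ => (h a c).mul (k c b) (hM a c) (hN c b) (hM' a c) (hN' c b))
    (fun c _ => integrable_mul_two (hM a c) (hN c b))
    (fun c _ => (integrable_mul_two (hM' a c) (hN c b)).add (integrable_mul_two (hM a c) (hN' c b)))

theorem MatDeriv.conjTranspose {θ : (ι → ℤ) →+ ℂ} (h : MatDeriv θ M N)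
    (hθ : ∀ n, conj (θ n) = -θ n) : MatDeriv θ (fun t => (M t)ᴴ) fun t => (N t)ᴴ :=
  fun a b => (h b a).conj hθ

end MatrixFunctions

/-! ### The Euler-Lagrange equation in divergence form -/

section EulerLagrange

variable {ι : Type*} [Fintype ι] {m : ℕ}

theorem entryLp_top_of_unitary {U : UnitAddTorus ι → Matrix (Fin m) (Fin m) ℂ}
    (hU : ∀ᵐ t, U t ∈ Matrix.unitaryGroup (Fin m) ℂ) (hU2 : EntryLp 2 U) : EntryLp ⊤ U :=
  fun a b => memLp_top_of_bound (hU2 a b).1 1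
    (hU.mono fun _ ht => entry_norm_bound_of_unitary ht a b)

/-- The derivative of the adjoint of a unitary-valued function. -/
theorem conjTranspose_deriv_ae {θ : (ι → ℤ) →+ ℂ} (hθ : ∀ n, conj (θ n) = -θ n)
    {U D : UnitAddTorus ι → Matrix (Fin m) (Fin m) ℂ}
    (hU : ∀ᵐ t, U t ∈ Matrix.unitaryGroup (Fin m) ℂ) (hU2 : EntryLp 2 U) (hD : EntryLp 2 D)
    (hd : MatDeriv θ U D) : ∀ᵐ t, (D t)ᴴ = -((U t)ᴴ * D t * (U t)ᴴ) := by
  classical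
  have hUt := entryLp_top_of_unitary hU hU2
  have h1 := (hd.conjTranspose hθ).mul hd hU2.conjTranspose hU2 hD.conjTranspose hD
  have h2 : EntryLp 2 fun t => (D t)ᴴ * U t + (U t)ᴴ * D t :=
    (hD.conjTranspose.mul_top hUt).add (hUt.conjTranspose.top_mul hD)
  -- The entries of `U* U` are constant: their coefficients vanish off frequency zero, and there the
  -- symbol vanishes. So all coefficients of the derivative are zero.
  have h3 (a b : Fin m) : (fun t => ((D t)ᴴ * U t + (U t)ᴴ * D t) a b) =ᵐ[volume] fun _ => 0 := by
    refine ae_eq_of_coeff_eq (h2 a b) (memLp_const 0) fun n => ?_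
    have h4 : (fun t => ((U t)ᴴ * U t) a b) =ᵐ[volume]
        fun t => (1 : Matrix (Fin m) (Fin m) ℂ) a b * mFourier 0 t := by
      filter_upwards [hU] with t ht
      have : (U t)ᴴ * U t = 1 := (Matrix.mem_unitaryGroup_iff' (n := Fin m)).mp ht
      rw [this, mFourier_zero]
      simp
    rw [h1 a b n, coeff_congr_ae h4, coeff_const_mul, coeff_one_mFourier]
    have hz : mFourierCoeff (fun _ : UnitAddTorus ι => (0 : ℂ)) n = 0 := by simp [coeff_def]
    rw [hz]
    split_ifs with hn
    · rw [hn, map_zero, zero_mul]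
    · simp
  have h5 : ∀ᵐ t, ∀ a b, ((D t)ᴴ * U t + (U t)ᴴ * D t) a b = 0 := by
    simp only [ae_all_iff]
    exact h3
  filter_upwards [h5, hU] with t h6 h7
  have h8 : U t * (U t)ᴴ = 1 := (Matrix.mem_unitaryGroup_iff (n := Fin m)).mp h7
  have h9 : (D t)ᴴ * U t = -((U t)ᴴ * D t) := by
    rw [eq_neg_iff_add_eq_zero]
    ext a b
    exact h6 a b
  calc (D t)ᴴ = (D t)ᴴ * U t * (U t)ᴴ := by rw [Matrix.mul_assoc, h8, Matrix.mul_one]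
    _ = _ := by rw [h9, Matrix.neg_mul]

/-- The lower order term of the Euler-Lagrange equation, at a point. -/
def lowerTerm (s : ℝ) (U D A A' G : Matrix (Fin m) (Fin m) ℂ) : Matrix (Fin m) (Fin m) ℂ :=
  D * U⁻¹ * D + (D * U⁻¹ * A * U - A' * U - A * D)
    + s • (-((D + A * U) * G) + U * G * U⁻¹ * (D + A * U))

theorem inv_eq_conjTranspose {V : Matrix (Fin m) (Fin m) ℂ}
    (h : V ∈ Matrix.unitaryGroup (Fin m) ℂ) : V⁻¹ = Vᴴ :=
  Matrix.inv_eq_right_inv ((Matrix.mem_unitaryGroup_iff (n := Fin m)).mp h)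

/-- The left side is the product rule for `∂ (U* D + U* A U)`, with the second derivative of `U`
replaced through the equation by the lower-order term. Substituting for `Dᴴ` cancels everything
except the commutator with `G`. -/
theorem lowerTerm_identity {s : ℝ} {U D A A' G : Matrix (Fin m) (Fin m) ℂ}
    (hU : U ∈ Matrix.unitaryGroup (Fin m) ℂ) (hD : Dᴴ = -(Uᴴ * D * Uᴴ)) :
    Dᴴ * D + Uᴴ * lowerTerm s U D A A' G + (Dᴴ * (A * U) + Uᴴ * (A' * U + A * D)) =
      s • (G * (Uᴴ * (D + A * U)) - Uᴴ * (D + A * U) * G) := by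
  have h1 : Uᴴ * U = 1 := (Matrix.mem_unitaryGroup_iff' (n := Fin m)).mp hU
  have h2 (X : Matrix (Fin m) (Fin m) ℂ) : Uᴴ * (U * X) = X := by
    rw [← Matrix.mul_assoc, h1, Matrix.one_mul]
  rw [lowerTerm, inv_eq_conjTranspose hU, hD]
  simp only [Matrix.mul_add, Matrix.mul_sub, Matrix.mul_smul, Matrix.mul_neg, Matrix.neg_mul,
    Matrix.add_mul, Matrix.mul_assoc, h2, smul_add, smul_neg, smul_sub]
  abel

/-- The term quadratic in `D` is what limits integrability to `L¹`. -/
theorem entryLp_lowerTerm {s : ℝ} {U D A A' : UnitAddTorus ι → Matrix (Fin m) (Fin m) ℂ}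
    {G : Matrix (Fin m) (Fin m) ℂ}
    (hU : ∀ᵐ t, U t ∈ Matrix.unitaryGroup (Fin m) ℂ) (hU2 : EntryLp 2 U) (hD : EntryLp 2 D)
    (hA : EntryLp ⊤ A) (hA' : EntryLp ⊤ A') :
    EntryLp 1 fun t => lowerTerm s (U t) (D t) (A t) (A' t) G := by
  have hUt := entryLp_top_of_unitary hU hU2
  have hinv : EntryLp ⊤ fun t => (U t)⁻¹ :=
    hUt.conjTranspose.congr (hU.mono fun t ht => (inv_eq_conjTranspose ht).symm)
  have h12 : (1 : ENNReal) ≤ 2 := by norm_num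
  have hG : EntryLp ⊤ fun _ : UnitAddTorus ι => G := EntryLp.const G
  have hE : EntryLp 2 fun t => D t + A t * U t := hD.add (hA.top_mul hU2)
  unfold lowerTerm
  refine (((hD.mul_top hinv).two_mul_two hD).add
    (((((hD.mul_top hinv).mul_top hA).mul_top hUt).mono h12).sub
      ((hA'.top_mul hU2).mono h12) |>.sub ((hA.top_mul hD).mono h12))).add (EntryLp.smul s ?_)
  exact ((hE.mul_top hG).mono h12).neg.add ((((hUt.top_mul hG).top_mul hinv).top_mul hE).mono h12)

/-- The equation `∑ ∂ⱼ Bⱼ = s ∑ [Gⱼ, Bⱼ]` for `Bⱼ = U* (∂ⱼU + Aⱼ U)`. -/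
theorem coeff_div_gauge {κ : Type*} [Fintype κ] {θ : κ → (ι → ℤ) →+ ℂ}
    (hθ : ∀ j n, conj (θ j n) = -θ j n) {s : ℝ}
    {U : UnitAddTorus ι → Matrix (Fin m) (Fin m) ℂ}
    {D A A' : κ → UnitAddTorus ι → Matrix (Fin m) (Fin m) ℂ} {g : κ → Fin m → ℂ}
    (hU : ∀ᵐ t, U t ∈ Matrix.unitaryGroup (Fin m) ℂ) (hU2 : EntryLp 2 U)
    (hD : ∀ j, EntryLp 2 (D j)) (hd : ∀ j, MatDeriv (θ j) U (D j))
    (hA : ∀ j, EntryLp ⊤ (A j)) (hA' : ∀ j, EntryLp ⊤ (A' j))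
    (hdA : ∀ j, MatDeriv (θ j) (A j) (A' j))
    (hEL : ∀ n a b, ∑ j, mFourierCoeff (fun t => -θ j n * D j t a b +
      lowerTerm s (U t) (D j t) (A j t) (A' j t) (Matrix.diagonal (g j)) a b) n = 0)
    (n : ι → ℤ) (a b : Fin m) :
    ∑ j, θ j n * mFourierCoeff (fun t => ((U t)ᴴ * (D j t + A j t * U t)) a b) n =
      ∑ j, s * (g j a - g j b) *
        mFourierCoeff (fun t => ((U t)ᴴ * (D j t + A j t * U t)) a b) n := by
  have hUt := entryLp_top_of_unitary hU hU2
  have h21 : (1 : ENNReal) ≤ 2 := by norm_num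
  set F : κ → UnitAddTorus ι → Matrix (Fin m) (Fin m) ℂ := fun j t =>
    lowerTerm s (U t) (D j t) (A j t) (A' j t) (Matrix.diagonal (g j)) with hF
  have hF1 (j) : EntryLp 1 (F j) := entryLp_lowerTerm hU hU2 (hD j) (hA j) (hA' j)
  have hdiv (c b : Fin m) (n : ι → ℤ) : ∑ j, θ j n * mFourierCoeff (fun t => D j t c b) n =
      mFourierCoeff (fun t => ∑ j, F j t c b) n := by
    have h := hEL n c b
    rw [coeff_sum _ fun j _ => (hF1 j).integrable c b, ← sub_eq_zero, ← Finset.sum_sub_distrib,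
      ← neg_eq_zero, ← Finset.sum_neg_distrib, ← h]
    refine Finset.sum_congr rfl fun j _ => ?_
    rw [coeff_add ((MemLp.integrable_two (hD j c b)).const_mul _) ((hF1 j).integrable c b),
      coeff_const_mul]
    ring
  -- The equation, with right side only in `L¹`, is multiplied by the bounded entries of `U*`.
  have hmul (c : Fin m) := coeff_div_mul (u := fun t => (U t)ᴴ a c)
    (Du := fun j t => (D j t)ᴴ a c) (C := 1) (hU2.conjTranspose a c).1
    (hU.mono fun t ht => by
      rw [Matrix.conjTranspose_apply, norm_star]
      exact entry_norm_bound_of_unitary ht c a)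
    (fun j => (hD j).conjTranspose a c) (fun j => (hd j).conjTranspose (hθ j) a c)
    (fun j => hD j c b) (integrable_finsetSum _ fun j _ => (hF1 j).integrable c b) (hdiv c b) n
  have hX1 (j) : EntryLp 2 fun t => (U t)ᴴ * D j t := hUt.conjTranspose.top_mul (hD j)
  have hAU (j) : EntryLp 2 fun t => A j t * U t := (hA j).top_mul hU2
  have hAU' (j) : EntryLp 2 fun t => A' j t * U t + A j t * D j t :=
    ((hA' j).top_mul hU2).add ((hA j).top_mul (hD j))
  have hA2 (j) : EntryLp 2 (A j) := (hA j).mono le_top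
  have hA2' (j) : EntryLp 2 (A' j) := (hA' j).mono le_top
  have hmain (j) (c : Fin m) : Integrable fun t => (U t)ᴴ a c * D j t c b :=
    integrable_mul_two (hU2.conjTranspose a c) (hD j c b)
  have hDD (j) (c : Fin m) : Integrable fun t => (D j t)ᴴ a c * D j t c b :=
    integrable_mul_two ((hD j).conjTranspose a c) (hD j c b)
  have hUF (c : Fin m) (j) : Integrable fun t => (U t)ᴴ a c * F j t c b :=
    memLp_one_iff_integrable.mp ((hF1 j c b).mul (hUt.conjTranspose a c))
  have hX : ∑ j, θ j n * mFourierCoeff (fun t => ((U t)ᴴ * D j t) a b) n =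
      ∑ j, mFourierCoeff (fun t => ((D j t)ᴴ * D j t + (U t)ᴴ * F j t) a b) n := by
    have h := Finset.sum_congr (rfl : (Finset.univ : Finset (Fin m)) = Finset.univ)
      fun c _ => hmul c
    have hL (j) : mFourierCoeff (fun t => ((U t)ᴴ * D j t) a b) n =
        ∑ c, mFourierCoeff (fun t => (U t)ᴴ a c * D j t c b) n := by
      simp only [Matrix.mul_apply]
      exact coeff_sum _ (fun c _ => hmain j c) n
    have hR (j) : mFourierCoeff (fun t => ((D j t)ᴴ * D j t + (U t)ᴴ * F j t) a b) n =
        ∑ c, mFourierCoeff (fun t => (D j t)ᴴ a c * D j t c b) n +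
        ∑ c, mFourierCoeff (fun t => (U t)ᴴ a c * F j t c b) n := by
      simp only [Matrix.mul_apply, Matrix.add_apply]
      rw [coeff_add (integrable_finsetSum _ fun c _ => hDD j c)
        (integrable_finsetSum _ fun c _ => hUF c j), coeff_sum _ (fun c _ => hDD j c),
        coeff_sum _ (fun c _ => hUF c j)]
    have hUFs (c : Fin m) : mFourierCoeff (fun t => (U t)ᴴ a c * ∑ j, F j t c b) n =
        ∑ j, mFourierCoeff (fun t => (U t)ᴴ a c * F j t c b) n := by
      simp only [Finset.mul_sum]
      exact coeff_sum _ (fun j _ => hUF c j) n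
    simp only [hL, hR, Finset.mul_sum, Finset.sum_add_distrib]
    simp only [hUFs, Finset.sum_add_distrib] at h
    rw [Finset.sum_comm, h, Finset.sum_comm]
    congr 1
    rw [Finset.sum_comm]
  -- The connection part `U* A U` has square-integrable factors and derivatives, so the ordinary
  -- product rule suffices.
  have hconn (j) : θ j n * mFourierCoeff (fun t => ((U t)ᴴ * (A j t * U t)) a b) n =
      mFourierCoeff (fun t => ((D j t)ᴴ * (A j t * U t) +
        (U t)ᴴ * (A' j t * U t + A j t * D j t)) a b) n :=
    (((hd j).conjTranspose (hθ j)).mul ((hdA j).mul (hd j) (hA2 j) hU2 (hA2' j) (hD j))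
      hU2.conjTranspose (hAU j) (hD j).conjTranspose (hAU' j) a b n).symm
  have hS1 (j) : EntryLp 1 fun t => (D j t)ᴴ * D j t + (U t)ᴴ * F j t :=
    ((hD j).conjTranspose.two_mul_two (hD j)).add (hUt.conjTranspose.top_mul (hF1 j))
  have hS2 (j) : EntryLp 1 fun t => (D j t)ᴴ * (A j t * U t) +
      (U t)ᴴ * (A' j t * U t + A j t * D j t) :=
    ((hD j).conjTranspose.two_mul_two (hAU j)).add
      (hU2.conjTranspose.two_mul_two (hAU' j))
  calc ∑ j, θ j n * mFourierCoeff (fun t => ((U t)ᴴ * (D j t + A j t * U t)) a b) n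
      = ∑ j, θ j n * mFourierCoeff (fun t => ((U t)ᴴ * D j t) a b) n +
        ∑ j, θ j n * mFourierCoeff (fun t => ((U t)ᴴ * (A j t * U t)) a b) n := by
        rw [← Finset.sum_add_distrib]
        refine Finset.sum_congr rfl fun j _ => ?_
        rw [← mul_add, ← coeff_add (MemLp.integrable_two (hX1 j a b))
          (MemLp.integrable_two (hUt.conjTranspose.top_mul (hAU j) a b))]
        simp only [Matrix.mul_add, Matrix.add_apply]
    _ = ∑ j, mFourierCoeff (fun t => s * (g j a - g j b) *
          ((U t)ᴴ * (D j t + A j t * U t)) a b) n := by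
        rw [hX, Finset.sum_congr rfl fun j _ => hconn j, ← Finset.sum_add_distrib]
        refine Finset.sum_congr rfl fun j _ => ?_
        rw [← coeff_add ((hS1 j).integrable a b) ((hS2 j).integrable a b)]
        refine coeff_congr_ae ?_ n
        filter_upwards [hU, conjTranspose_deriv_ae (hθ j) hU hU2 (hD j) (hd j)] with t h1 h2
        have h3 := congrFun (congrFun (lowerTerm_identity (s := s) (A := A j t) (A' := A' j t)
          (G := Matrix.diagonal (g j)) h1 h2) a) b
        rw [Matrix.add_apply] at h3
        rw [h3, Matrix.smul_apply, Matrix.sub_apply, Matrix.diagonal_mul, Matrix.mul_diagonal,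
          Complex.real_smul]
        ring
    _ = _ := Finset.sum_congr rfl fun j _ => coeff_const_mul _ _ n

end EulerLagrange

/-! ### Exponential decay of the Fourier coefficients of the gauge -/

section GaugeDecay

variable {ι : Type*} [Fintype ι] {m : ℕ}

theorem norm_coeff_mul_le {f g : UnitAddTorus ι → ℂ} (hf : MemLp f 2 volume)
    (hg : MemLp g 2 volume) {C ε M : ℝ} (hε : 0 < ε) {b : (ι → ℤ) → ℝ} (hM : ∀ n, b n ≤ M)
    (hfC : ∀ n, ‖mFourierCoeff f n‖ ≤ C * Real.exp (-(ε * ‖n‖)))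
    (hgb : ∀ n, ‖mFourierCoeff g n‖ ≤ b n) (n : ι → ℤ) :
    ‖mFourierCoeff (fun t => f t * g t) n‖ ≤
      C * ∑' k, Real.exp (-(ε * ‖k‖)) * b (n - k) := by
  have hb (n) : 0 ≤ b n := (norm_nonneg _).trans (hgb n)
  have hs : Summable fun k => Real.exp (-(ε * ‖k‖)) * b (n - k) :=
    Summable.of_nonneg_of_le (fun k => mul_nonneg (Real.exp_pos _).le (hb _))
      (fun k => mul_le_mul_of_nonneg_left (hM _) (Real.exp_pos _).le)
      ((summable_exp_neg_mul_norm hε).mul_right M)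
  rw [← (hasSum_coeff_mul hf hg n).tsum_eq]
  refine tsum_of_norm_bounded (hs.hasSum.mul_left C) fun k => ?_
  rw [norm_mul, ← mul_assoc]
  exact mul_le_mul (hfC k) (hgb _) (norm_nonneg _) ((norm_nonneg _).trans (hfC k))

/-- A solution of the linear system `∂ⱼU = U Bⱼ - Aⱼ U` whose coefficients have exponentially
decaying Fourier coefficients has itself exponentially decaying Fourier coefficients. -/
theorem expDecay_of_deriv {κ : Type*} [Fintype κ] {θ : κ → (ι → ℤ) →+ ℂ} {K : ℝ} (hK0 : 0 ≤ K)
    (hK : ∀ n, ‖n‖ ≤ K * ∑ j, ‖θ j n‖)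
    {U : UnitAddTorus ι → Matrix (Fin m) (Fin m) ℂ}
    {D A B : κ → UnitAddTorus ι → Matrix (Fin m) (Fin m) ℂ}
    (hU : ∀ᵐ t, U t ∈ Matrix.unitaryGroup (Fin m) ℂ) (hU2 : EntryLp 2 U)
    (hd : ∀ j, MatDeriv (θ j) U (D j))
    (hA : ∀ j, EntryLp 2 (A j)) (hB : ∀ j, EntryLp 2 (B j))
    (hAd : ∀ j a b, ExpDecay fun n => mFourierCoeff (fun t => A j t a b) n)
    (hBd : ∀ j a b, ExpDecay fun n => mFourierCoeff (fun t => B j t a b) n)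
    (heq : ∀ j, ∀ᵐ t, D j t = U t * B j t - A j t * U t) (a b : Fin m) :
    ExpDecay fun n => mFourierCoeff (fun t => U t a b) n := by
  obtain ⟨C₁, ε₁, hC₁, hε₁, H⟩ := ExpDecay.exists_common
    (κ := (κ × Fin m × Fin m) ⊕ (κ × Fin m × Fin m))
    (a := Sum.elim (fun z n => mFourierCoeff (fun t => A z.1 t z.2.1 z.2.2) n)
      (fun z n => mFourierCoeff (fun t => B z.1 t z.2.1 z.2.2) n))
    (by rintro (z | z); exacts [hAd z.1 z.2.1 z.2.2, hBd z.1 z.2.1 z.2.2])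
  -- Summing the moduli over all entries turns the coupled system into one scalar convolution
  -- inequality. Its a priori bound comes from the entries of a unitary matrix having modulus at
  -- most one.
  set β : (ι → ℤ) → ℝ := fun n => ∑ a, ∑ b, ‖mFourierCoeff (fun t => U t a b) n‖ with hβ
  have hβ0 (n) : 0 ≤ β n := Finset.sum_nonneg fun a _ => Finset.sum_nonneg fun b _ => norm_nonneg _
  have hle (a b : Fin m) (n) : ‖mFourierCoeff (fun t => U t a b) n‖ ≤ β n :=
    (Finset.single_le_sum (f := fun b => ‖mFourierCoeff (fun t => U t a b) n‖)
      (fun _ _ => norm_nonneg _) (Finset.mem_univ b)).trans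
    (Finset.single_le_sum (f := fun a => ∑ b, ‖mFourierCoeff (fun t => U t a b) n‖)
      (fun _ _ => Finset.sum_nonneg fun _ _ => norm_nonneg _) (Finset.mem_univ a))
  have hβM (n) : β n ≤ ∑ _a : Fin m, ∑ _b : Fin m, (1 : ℝ) :=
    Finset.sum_le_sum fun a _ => Finset.sum_le_sum fun b _ =>
      norm_coeff_le (hU.mono fun t ht => entry_norm_bound_of_unitary ht a b) n
  set S : (ι → ℤ) → ℝ := fun n => ∑' k, Real.exp (-(ε₁ * ‖k‖)) * β (n - k) with hS
  have hentry (j : κ) (a b : Fin m) (n) :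
      ‖θ j n‖ * ‖mFourierCoeff (fun t => U t a b) n‖ ≤ m * (2 * C₁ * S n) := by
    have h1 : (fun t => D j t a b) =ᵐ[volume]
        fun t => ∑ c, (B j t c b * U t a c - A j t a c * U t c b) := by
      filter_upwards [heq j] with t ht
      rw [ht, Matrix.sub_apply, Matrix.mul_apply, Matrix.mul_apply, ← Finset.sum_sub_distrib]
      simp only [mul_comm (U t a _)]
    rw [← norm_mul, ← hd j a b n, coeff_congr_ae h1,
      coeff_sum _ (F := fun c t => B j t c b * U t a c - A j t a c * U t c b) fun c _ =>
      (integrable_mul_two (hB j c b) (hU2 a c)).sub (integrable_mul_two (hA j a c) (hU2 c b))]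
    have h2 (c : Fin m) : ‖mFourierCoeff
        (fun t => B j t c b * U t a c - A j t a c * U t c b) n‖ ≤ 2 * C₁ * S n := by
      rw [coeff_sub (integrable_mul_two (hB j c b) (hU2 a c))
        (integrable_mul_two (hA j a c) (hU2 c b))]
      have h3 := norm_coeff_mul_le (hB j c b) (hU2 a c) hε₁ hβM
        (H (Sum.inr (j, c, b))) (hle a c) n
      have h4 := norm_coeff_mul_le (hA j a c) (hU2 c b) hε₁ hβM
        (H (Sum.inl (j, a, c))) (hle c b) n
      refine (norm_sub_le _ _).trans ?_
      linarith
    refine (norm_sum_le_of_le _ fun c _ => h2 c).trans (le_of_eq ?_)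
    simp
  obtain ⟨C, hC, hdec⟩ := exp_decay_of_conv_le (b := β)
    (K := K * (Fintype.card κ * (m * (m * (m * (2 * C₁)))))) (by positivity) hε₁ hβ0 hβM
    fun n => by
      have h1 : (∑ j, ‖θ j n‖) * β n ≤
          ∑ _j : κ, ∑ _a : Fin m, ∑ _b : Fin m, m * (2 * C₁ * S n) := by
        rw [Finset.sum_mul]
        refine Finset.sum_le_sum fun j _ => ?_
        simp only [hβ, Finset.mul_sum]
        exact Finset.sum_le_sum fun a _ => Finset.sum_le_sum fun b _ => hentry j a b n
      calc ‖n‖ * β n ≤ (K * ∑ j, ‖θ j n‖) * β n :=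
            mul_le_mul_of_nonneg_right (hK n) (hβ0 n)
        _ = K * ((∑ j, ‖θ j n‖) * β n) := by ring
        _ ≤ K * ∑ _j : κ, ∑ _a : Fin m, ∑ _b : Fin m, m * (2 * C₁ * S n) := by gcongr
        _ = _ := by simp; ring
  exact ⟨C, ε₁ / 2, hC, by positivity, fun n => (hle a b n).trans (hdec n)⟩

/-- Where `c n ≠ 0` one has `θ n = z`, and injectivity allows at most one such `n`. This is the step
for `d = 1`, where a single derivative already has injective symbol. -/
theorem expDecay_of_symbol_mul_eq {θ : (ι → ℤ) →+ ℂ} (hθ : Function.Injective θ)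
    {c : (ι → ℤ) → ℂ} {z : ℂ} (h : ∀ n, θ n * c n = z * c n) : ExpDecay c := by
  classical
  have h' (n) (hn : θ n ≠ z) : c n = 0 := by
    have : (θ n - z) * c n = 0 := by rw [sub_mul, h, sub_self]
    exact (mul_eq_zero.mp this).resolve_left (sub_ne_zero.mpr hn)
  by_cases hz : ∃ n₀, θ n₀ = z
  · obtain ⟨n₀, hn₀⟩ := hz
    refine ExpDecay.of_finite_support (s := {n₀}) fun n hn => h' n fun hn' => hn ?_
    rw [Finset.mem_singleton]
    exact hθ (hn'.trans hn₀.symm)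
  · exact ExpDecay.of_finite_support (s := ∅) fun n _ => h' n fun hn' => hz ⟨n, hn'⟩

/-- A curl-free field whose divergence is that of an exponentially decaying field decays
exponentially. -/
theorem expDecay_of_curl_div {κ : Type*} [Fintype κ] {τ : κ → (ι → ℤ) → ℝ}
    (hτ : ∀ n, n ≠ 0 → ∃ j, τ j n ≠ 0) {x α : κ → (ι → ℤ) → ℂ}
    (hα : ∀ j, ExpDecay (α j))
    (hcurl : ∀ i j n, (τ i n : ℂ) * x j n = τ j n * x i n)
    (hdiv : ∀ n, ∑ j, (τ j n : ℂ) * (x j n + α j n) = 0) (j : κ) : ExpDecay (x j) := by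
  classical
  have hα' : ExpDecay fun n => ∑ i, ((‖α i n‖ : ℝ) : ℂ) :=
    ExpDecay.sum fun i => (hα i).of_norm_le (K := 1) fun n => by simp
  -- The mean value is invisible to divergence and curl, but a single frequency cannot affect decay.
  have h0 : ExpDecay fun n => if n = 0 then x j n else 0 :=
    ExpDecay.of_finite_support (s := {0}) fun n hn => by
      rw [if_neg (by simpa using hn)]
  have h1 : ExpDecay fun n => if n = 0 then 0 else x j n := by
    refine hα'.of_norm_le (K := 1) fun n => ?_
    rw [one_mul, ← Complex.ofReal_sum, Complex.norm_real,
      Real.norm_of_nonneg (Finset.sum_nonneg fun _ _ => norm_nonneg _)]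
    split_ifs with hn
    · rw [norm_zero]
      exact Finset.sum_nonneg fun _ _ => norm_nonneg _
    · set Q : ℝ := ∑ i, τ i n ^ 2 with hQ
      have hQ0 : 0 < Q := by
        obtain ⟨i, hi⟩ := hτ n hn
        exact Finset.sum_pos' (fun i _ => sq_nonneg _) ⟨i, Finset.mem_univ i, by positivity⟩
      have hτQ (i : κ) : τ i n ^ 2 ≤ Q :=
        Finset.single_le_sum (f := fun i => τ i n ^ 2) (fun _ _ => sq_nonneg _) (Finset.mem_univ i)
      -- The Fourier form of the Helmholtz projection: the curl condition gives `|τ|² x_j = τ_j ∑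
      -- τ_i x_i`, and the divergence condition replaces the sum by `-∑ τ_i α_i`. The multiplier
      -- `τ_j τ_i / |τ|²` is bounded by one.
      have hid : (Q : ℂ) * x j n = -∑ i, (τ j n * τ i n : ℝ) * α i n := by
        have h2 : (Q : ℂ) * x j n = ∑ i, (τ j n : ℂ) * (τ i n * x i n) := by
          rw [hQ]
          push_cast
          rw [Finset.sum_mul]
          refine Finset.sum_congr rfl fun i _ => ?_
          rw [pow_two, mul_assoc, hcurl i j n]
          ring
        have h3 := hdiv n
        simp only [mul_add, Finset.sum_add_distrib] at h3
        rw [h2, ← Finset.mul_sum, eq_neg_of_add_eq_zero_left h3, mul_neg, Finset.mul_sum]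
        congr 1
        refine Finset.sum_congr rfl fun i _ => ?_
        push_cast
        ring
      have hn1 : Q * ‖x j n‖ ≤ Q * ∑ i, ‖α i n‖ := by
        calc Q * ‖x j n‖ = ‖(Q : ℂ) * x j n‖ := by
              rw [norm_mul, Complex.norm_real, Real.norm_of_nonneg hQ0.le]
          _ ≤ ∑ i, Q * ‖α i n‖ := by
              rw [hid, norm_neg]
              refine norm_sum_le_of_le _ fun i _ => ?_
              rw [norm_mul, Complex.norm_real, Real.norm_eq_abs]
              gcongr
              rw [abs_le]
              constructor <;> nlinarith [hτQ i, hτQ j, sq_nonneg (τ i n + τ j n),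
                sq_nonneg (τ i n - τ j n)]
          _ = _ := by rw [Finset.mul_sum]
      exact le_of_mul_le_mul_left hn1 hQ0
  have := h0.add h1
  refine this.of_norm_le (K := 1) fun n => ?_
  split_ifs <;> simp

end GaugeDecay

/-! ### The Berry connection -/

section Berry

variable {d m : ℕ} {γ : Module.Basis (Fin d) ℝ (Space d)} {χ : Fin m → Space d → Fiber γ}

theorem analyticOnNhd_berry (hχ : ∀ a, AnalyticOnNhd ℝ (χ a) Set.univ) (j : Fin d) (a b : Fin m) :
    AnalyticOnNhd ℝ (fun k => berry χ j k a b) Set.univ := by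
  rw [← contDiff_omega_iff_analyticOnNhd]
  have h1 : ContDiff ℝ ω (fderiv ℝ (χ b)) := contDiff_omega_iff_analyticOnNhd.mpr (hχ b).fderiv
  exact (contDiff_omega_iff_analyticOnNhd.mpr (hχ a)).inner ℂ (h1.clm_apply contDiff_const)

/-- Continuity upgrades the almost-everywhere equivariance of the frame to every `k`. As `τ(l)` is
unitary and independent of `k`, it commutes with `∂_j` and drops out of the inner product. -/
theorem isPeriodic_berry {P : Space d → Fiber γ →L[ℂ] Fiber γ} (hB : IsBlochFrame γ P χ)
    (hχ : ∀ a, AnalyticOnNhd ℝ (χ a) Set.univ) (j : Fin d) : IsPeriodic γ (berry χ j) := by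
  have hcd (a) : ContDiff ℝ ω (χ a) := contDiff_omega_iff_analyticOnNhd.mpr (hχ a)
  have heq (a : Fin m) (l : dualLattice γ) : (fun k => χ a (k - l)) = fun k => tau γ l (χ a k) := by
    refine (Continuous.ae_eq_iff_eq volume ?_ ?_).mp ((hB.quasiBloch a).memHTau.equivariant l)
    · exact (hcd a).continuous.comp (continuous_id.sub continuous_const)
    · exact (tau γ l).continuous.comp (hcd a).continuous
  have hder (a : Fin m) (l : dualLattice γ) (k : Space d) :
      partialDeriv j (χ a) (k - l) = tau γ l (partialDeriv j (χ a) k) := by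
    have h1 : HasFDerivAt (fun k => tau γ l (χ a k))
        ((((tau γ l).toContinuousLinearEquiv : Fiber γ →L[ℂ] Fiber γ).restrictScalars ℝ).comp
          (fderiv ℝ (χ a) k)) k :=
      (((tau γ l).toContinuousLinearEquiv : Fiber γ →L[ℂ] Fiber γ).restrictScalars
        ℝ).hasFDerivAt.comp k
        (((hcd a).differentiable (by simp)).differentiableAt (x := k)).hasFDerivAt
    have h2 : fderiv ℝ (χ a) (k - l) = fderiv ℝ (fun k => χ a (k - l)) k := by
      simp only [sub_eq_add_neg]
      rw [fderiv_comp_add_right]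
    rw [partialDeriv, h2, heq a l, h1.fderiv]
    rfl
  intro k l hl
  ext a b
  have ha := congrFun (heq a ⟨-l, neg_mem hl⟩) k
  have hb := hder b ⟨-l, neg_mem hl⟩ k
  simp only [sub_neg_eq_add] at ha hb
  simp only [berry, Matrix.of_apply]
  rw [ha, hb, LinearIsometryEquiv.inner_map_map]

end Berry

/-! ### Weak equations in terms of Fourier coefficients -/

section Weak

variable {d m : ℕ} {γ : Module.Basis (Fin d) ℝ (Space d)}

theorem trace_single_conjTranspose_mul (a b : Fin m) (x : ℂ) (M : Matrix (Fin m) (Fin m) ℂ) :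
    ((Matrix.single a b x)ᴴ * M).trace = conj x * M a b := by
  rw [Matrix.conjTranspose_single, Matrix.trace_single_mul]
  rfl

theorem matPartialDeriv_single (j : Fin d) (a b : Fin m) (n : Fin d → ℤ) (k : Space d) :
    matPartialDeriv j (fun k => Matrix.single a b (char γ n k)) k =
      Matrix.single a b (symbol γ (EuclideanSpace.single j 1) n * char γ n k) := by
  ext a' b'
  simp only [matPartialDeriv, partialDeriv, Matrix.of_apply, Matrix.single_apply]
  split_ifs with h
  · exact fderiv_char γ n k _
  · simp

theorem isTestFunction_single (a b : Fin m) (n : Fin d → ℤ) :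
    IsTestFunction γ fun k => Matrix.single a b (char γ n k) := by
  refine ⟨fun k l hl => by simp only [isPeriodic_char γ n k l hl], fun a' b' => ?_⟩
  simp only [Matrix.single_apply]
  split_ifs with h
  · exact contDiff_char γ n
  · exact contDiff_const

/-- Testing against a character placed in one matrix entry reads off one Fourier coefficient of that
entry. -/
theorem IsWeakGradient.matDeriv {U : Space d → Matrix (Fin m) (Fin m) ℂ}
    {DU : Fin d → Space d → Matrix (Fin m) (Fin m) ℂ} (h : IsWeakGradient γ U DU) (j : Fin d) :
    MatDeriv (symbol γ (EuclideanSpace.single j 1)) (fun t => U (cellSection γ t))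
      fun t => DU j (cellSection γ t) := by
  intro a b n
  obtain ⟨c, hc0, hc⟩ := exists_integral_cellSection γ
  have h1 := h.integral_eq j _ (isTestFunction_single a b n)
  simp only [matPartialDeriv_single, trace_single_conjTranspose_mul, map_mul, conj_symbol,
    conj_char] at h1
  have h2 := congrArg (fun z => (c : ℂ) * z) h1
  simp only [mul_neg, ← hc, char_cellSection] at h2
  rw [coeff_def, coeff_def, ← integral_const_mul, ← neg_inj, ← h2, ← integral_neg]
  congr 1
  ext t
  ring

theorem coeff_eulerLagrange {s : ℝ} {A : Fin d → Space d → Matrix (Fin m) (Fin m) ℂ}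
    {U : Space d → Matrix (Fin m) (Fin m) ℂ}
    {DU : Fin d → Space d → Matrix (Fin m) (Fin m) ℂ}
    (h : ∀ φ : Space d → Matrix (Fin m) (Fin m) ℂ, IsTestFunction γ φ →
      ∑ j, ∫ k in dualCell γ,
        ((matPartialDeriv j φ k)ᴴ * DU j k + (φ k)ᴴ * lowerOrder γ s A U DU j k).trace = 0)
    (n : Fin d → ℤ) (a b : Fin m) :
    ∑ j, mFourierCoeff (fun t => -symbol γ (EuclideanSpace.single j 1) n *
        DU j (cellSection γ t) a b + lowerOrder γ s A U DU j (cellSection γ t) a b) n = 0 := by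
  obtain ⟨c, hc0, hc⟩ := exists_integral_cellSection γ
  have h1 := h _ (isTestFunction_single a b n)
  simp only [matPartialDeriv_single, Matrix.trace_add, trace_single_conjTranspose_mul, map_mul,
    conj_symbol, conj_char] at h1
  have h2 := congrArg (fun z => (c : ℂ) * z) h1
  simp only [mul_zero, Finset.mul_sum, ← hc, char_cellSection] at h2
  rw [← h2]
  refine Finset.sum_congr rfl fun j _ => ?_
  rw [coeff_def]
  congr 1
  ext t
  ring

theorem symbol_single (j : Fin d) (n : Fin d → ℤ) :
    symbol γ (EuclideanSpace.single j 1) n = Complex.I * (freq γ n j : ℝ) := by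
  rw [symbol_apply, EuclideanSpace.inner_single_right]
  simp

theorem exists_norm_freq_le (γ : Module.Basis (Fin d) ℝ (Space d)) :
    ∃ M : ℝ, 0 ≤ M ∧ ∀ n, ‖freq γ n‖ ≤ M * ‖n‖ := by
  refine ⟨∑ j, ‖γ j‖, Finset.sum_nonneg fun _ _ => norm_nonneg _, fun n => ?_⟩
  rw [freq, Finset.sum_mul]
  refine norm_sum_le_of_le _ fun j _ => ?_
  rw [norm_smul, mul_comm]
  gcongr
  simpa [Int.norm_eq_abs] using norm_le_pi_norm n j

/-- Ellipticity of the gradient: the partial symbols are the Cartesian components of `freq γ n`, and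
`n` is recovered from that vector by a bounded linear map. -/
theorem exists_norm_le_symbol (γ : Module.Basis (Fin d) ℝ (Space d)) : ∃ K : ℝ, 0 ≤ K ∧
    ∀ n : Fin d → ℤ, ‖n‖ ≤ K * ∑ j, ‖symbol γ (EuclideanSpace.single j 1) n‖ := by
  set L : Space d →L[ℝ] (Fin d → ℝ) := γ.equivFunL.toContinuousLinearMap with hL
  refine ⟨‖L‖, norm_nonneg _, fun n => ?_⟩
  have h1 : ‖freq γ n‖ ≤ ∑ j, ‖symbol γ (EuclideanSpace.single j 1) n‖ := by
    conv_lhs => rw [← (EuclideanSpace.basisFun (Fin d) ℝ).sum_repr (freq γ n)]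
    refine norm_sum_le_of_le _ fun j _ => ?_
    rw [symbol_single]
    simp [norm_smul]
  refine (pi_norm_le_iff_of_nonneg (by positivity)).mpr fun j => ?_
  have h2 : ‖n j‖ = ‖L (freq γ n) j‖ := by
    have : L (freq γ n) j = n j := repr_freq γ n j
    rw [this, Int.norm_eq_abs, Real.norm_eq_abs]
  rw [h2]
  exact (norm_le_pi_norm _ j).trans ((L.le_opNorm _).trans (by gcongr))

end Weak

/-! ### Functions with exponentially decaying Fourier coefficients -/

section Series

variable {d : ℕ} {γ : Module.Basis (Fin d) ℝ (Space d)}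

theorem analyticOnNhd_tsum_char {a : (Fin d → ℤ) → ℂ} (ha : ExpDecay a) :
    AnalyticOnNhd ℝ (fun k => ∑' n, a n * char γ n k) Set.univ := by
  obtain ⟨M, hM0, hM⟩ := exists_norm_freq_le γ
  refine analyticOnNhd_tsum_exp ha
    (fun n => (Complex.I • Complex.ofRealCLM).comp (innerSL ℝ (freq γ n))) hM0 (fun n => ?_)
    fun n x => ?_
  · refine ContinuousLinearMap.opNorm_le_bound _ (by positivity) fun x => ?_
    have h1 : ‖⟪freq γ n, x⟫_ℝ‖ ≤ M * ‖n‖ * ‖x‖ :=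
      (norm_inner_le_norm _ _).trans (by gcongr; exact hM n)
    simpa using h1
  · simp

/-- The series converges absolutely in the uniform norm as well as in `L²`, and the two limits
agree. -/
theorem ae_eq_tsum_char {f : UnitAddTorus (Fin d) → ℂ} (hf : MemLp f 2 volume)
    (ha : ExpDecay fun n => mFourierCoeff f n) :
    ∀ᵐ t, f t = ∑' n, mFourierCoeff f n * char γ n (cellSection γ t) := by
  have hs : Summable fun n => mFourierCoeff f n • (mFourier n : C(UnitAddTorus (Fin d), ℂ)) := by
    refine Summable.of_norm ?_
    simpa only [norm_smul, mFourier_norm, mul_one] using ha.summable_norm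
  set F : C(UnitAddTorus (Fin d), ℂ) := ∑' n, mFourierCoeff f n • mFourier n with hF
  have h1 : HasSum (fun n => mFourierCoeff f n • mFourierLp 2 n)
      (ContinuousMap.toLp (E := ℂ) 2 volume ℂ F) := by
    have := hs.hasSum.mapL (ContinuousMap.toLp (E := ℂ) 2
      (volume : Measure (UnitAddTorus (Fin d))) ℂ)
    simpa only [map_smul] using this
  have h2 := hasSum_mFourier_series_L2 (hf.toLp f)
  simp only [coeff_toLp] at h2
  have h3 := h2.unique h1
  filter_upwards [hf.coeFn_toLp, ContinuousMap.coeFn_toLp (𝕜 := ℂ) (p := 2) volume F] with t h4 h5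
  rw [← h4, h3, h5]
  have h6 := hs.hasSum.mapL (ContinuousMap.evalCLM ℂ t)
  rw [← hF] at h6
  have h7 : F t = ∑' n, mFourierCoeff f n * mFourier n t := by
    simpa using h6.tsum_eq.symm
  rw [h7]
  simp only [char_cellSection]

end Series

/-! ### Regularity -/

section Regularity

variable {d m : ℕ} {γ : Module.Basis (Fin d) ℝ (Space d)}

theorem isRealAnalytic_of_expDecay {U : Space d → Matrix (Fin m) (Fin m) ℂ}
    (hU : MemW12Unitary γ U)
    (hdec : ∀ a b, ExpDecay fun n => mFourierCoeff (fun t => U (cellSection γ t) a b) n) :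
    IsRealAnalytic γ U := by
  have hU2 (a b) := memLp_comp_cellSection γ (hU.memL2.memLp a b)
  set V : Space d → Matrix (Fin m) (Fin m) ℂ := fun k => Matrix.of fun a b =>
    ∑' n, mFourierCoeff (fun t => U (cellSection γ t) a b) n * char γ n k with hV
  have hVper : IsPeriodic γ V := fun k l hl => by
    ext a b
    simp only [hV, Matrix.of_apply, isPeriodic_char γ _ k l hl]
  have hVan (a b) : AnalyticOnNhd ℝ (fun k => V k a b) Set.univ :=
    analyticOnNhd_tsum_char (hdec a b)
  have hUV : U =ᵐ[volume] V := by
    refine hU.memL2.periodic.ae_eq hVper ?_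
    have : ∀ᵐ t, ∀ a b, U (cellSection γ t) a b = V (cellSection γ t) a b := by
      simp only [ae_all_iff]
      exact fun a b => ae_eq_tsum_char (hU2 a b) (hdec a b)
    filter_upwards [this] with t ht
    ext a b
    exact ht a b
  have hVc : Continuous V := continuous_matrix fun a b =>
    (contDiff_omega_iff_analyticOnNhd.mpr (hVan a b)).continuous
  refine ⟨V, hVper, ?_, hVan, hUV⟩
  -- Unitarity passes from almost every `k` to every `k` by continuity of `V`.
  have hone : (fun k => V k * (V k)ᴴ) =ᵐ[volume] fun _ => 1 := by
    filter_upwards [hUV, hU.unitary] with k h1 h2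
    rw [← h1]
    exact Matrix.mem_unitaryGroup_iff.mp h2
  have hone' := (Continuous.ae_eq_iff_eq volume (hVc.matrix_mul hVc.matrix_conjTranspose)
    continuous_const).mp hone
  exact fun k => Matrix.mem_unitaryGroup_iff.mpr (congrFun hone' k)

/-- In rank one, the logarithmic derivative of a unitary function has vanishing curl. -/
theorem coeff_curl_rank_one {ι : Type*} [Fintype ι] {θ₁ θ₂ : (ι → ℤ) →+ ℂ}
    (hθ₁ : ∀ n, conj (θ₁ n) = -θ₁ n) (hθ₂ : ∀ n, conj (θ₂ n) = -θ₂ n)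
    {U D₁ D₂ : UnitAddTorus ι → Matrix (Fin 1) (Fin 1) ℂ}
    (hU : ∀ᵐ t, U t ∈ Matrix.unitaryGroup (Fin 1) ℂ) (hU2 : EntryLp 2 U)
    (hD₁ : EntryLp 2 D₁) (hD₂ : EntryLp 2 D₂) (h₁ : MatDeriv θ₁ U D₁) (h₂ : MatDeriv θ₂ U D₂)
    (n : ι → ℤ) :
    θ₁ n * mFourierCoeff (fun t => ((U t)ᴴ * D₂ t) 0 0) n =
      θ₂ n * mFourierCoeff (fun t => ((U t)ᴴ * D₁ t) 0 0) n := by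
  have h := coeff_curl_mul (hU2.conjTranspose 0 0) (hD₁.conjTranspose 0 0)
    (hD₂.conjTranspose 0 0) (hD₁ 0 0) (hD₂ 0 0) (h₁.conjTranspose hθ₁ 0 0)
    (h₂.conjTranspose hθ₂ 0 0) (h₁ 0 0) (h₂ 0 0) n
  -- For scalars `∂ū = -ū² ∂u`, so `∂₁ū ∂₂u` is symmetric in the two directions. This uses
  -- commutativity and fails for larger matrices.
  have hsym : (fun t => (D₁ t)ᴴ 0 0 * D₂ t 0 0) =ᵐ[volume] fun t => (D₂ t)ᴴ 0 0 * D₁ t 0 0 := by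
    filter_upwards [conjTranspose_deriv_ae hθ₁ hU hU2 hD₁ h₁,
      conjTranspose_deriv_ae hθ₂ hU hU2 hD₂ h₂] with t e₁ e₂
    rw [e₁, e₂]
    simp only [Matrix.neg_apply, Matrix.mul_apply, Fin.sum_univ_one]
    ring
  rw [coeff_congr_ae hsym, sub_self, sub_eq_zero] at h
  simpa only [Matrix.mul_apply, Fin.sum_univ_one] using h

/-- Decay is established for `B_j` first, separately for `d = 1` and `m = 1`, and then transferred
to `U` by the linear system `∂_jU = U B_j - A_j U`. -/
theorem expDecay_of_isWeakSolution (hdm : d = 1 ∨ m = 1)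
    {P : Space d → Fiber γ →L[ℂ] Fiber γ} {χ : Fin m → Space d → Fiber γ}
    (hχ : IsBlochFrame γ P χ) (hχa : ∀ a, AnalyticOnNhd ℝ (χ a) Set.univ) {s : ℝ}
    {U : Space d → Matrix (Fin m) (Fin m) ℂ} (hU : MemW12Unitary γ U)
    (hEL : IsWeakSolution γ s (berry χ) U) (a b : Fin m) :
    ExpDecay fun n => mFourierCoeff (fun t => U (cellSection γ t) a b) n := by
  obtain ⟨DU, hgrad, hweak⟩ := hEL
  set θ : Fin d → (Fin d → ℤ) →+ ℂ := fun j => symbol γ (EuclideanSpace.single j 1) with hθdef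
  have hθ (j n) : conj (θ j n) = -θ j n := conj_symbol γ _ n
  set Ut : UnitAddTorus (Fin d) → Matrix (Fin m) (Fin m) ℂ := fun t => U (cellSection γ t)
  set D : Fin d → UnitAddTorus (Fin d) → Matrix (Fin m) (Fin m) ℂ :=
    fun j t => DU j (cellSection γ t)
  set A : Fin d → UnitAddTorus (Fin d) → Matrix (Fin m) (Fin m) ℂ :=
    fun j t => berry χ j (cellSection γ t)
  set A' : Fin d → UnitAddTorus (Fin d) → Matrix (Fin m) (Fin m) ℂ :=
    fun j t => matPartialDeriv j (berry χ j) (cellSection γ t)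
  have hUu : ∀ᵐ t, Ut t ∈ Matrix.unitaryGroup (Fin m) ℂ :=
    (ae_cellSection_iff γ (p := fun k => U k ∈ Matrix.unitaryGroup (Fin m) ℂ)).mpr
      (ae_restrict_of_ae hU.unitary)
  have hU2 : EntryLp 2 Ut := fun a b => memLp_comp_cellSection γ (hU.memL2.memLp a b)
  have hUt := entryLp_top_of_unitary hUu hU2
  have hD (j) : EntryLp 2 (D j) := fun a b =>
    memLp_comp_cellSection γ ((hgrad.memL2 j).memLp a b)
  have hd (j) : MatDeriv (θ j) Ut (D j) := hgrad.matDeriv j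
  have hper (j) (a b : Fin m) : IsPeriodic γ fun k => berry χ j k a b := fun k l hl => by
    simp only [isPeriodic_berry hχ hχa j k l hl]
  have han (j) (a b : Fin m) := analyticOnNhd_berry hχa j a b
  have hcd (j) (a b : Fin m) : ContDiff ℝ 1 fun k => berry χ j k a b :=
    (contDiff_omega_iff_analyticOnNhd.mpr (han j a b)).of_le le_top
  have hA (j) : EntryLp ⊤ (A j) := fun a b => (hper j a b).memLp_top (hcd j a b).continuous
  have hA' (j) : EntryLp ⊤ (A' j) := fun a b => by
    refine IsPeriodic.memLp_top (γ := γ) (f := fun k => matPartialDeriv j (berry χ j) k a b)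
      (fun k l hl => ?_) ?_
    · simp only [matPartialDeriv, partialDeriv, Matrix.of_apply,
        (hper j a b).periodic_fderiv k l hl]
    · exact ((hcd j a b).continuous_fderiv (by simp)).clm_apply continuous_const
  have hdA (j) : MatDeriv (θ j) (A j) (A' j) := fun a b => (hper j a b).hasFourierDeriv (hcd j a b) _
  set g : Fin d → Fin m → ℂ := fun j a =>
    ∫ k in dualCell γ, ((U k)ᴴ * (DU j k + berry χ j k * U k)) a a
  have hdiv := coeff_div_gauge (s := s) (g := g) hθ hUu hU2 hD hd hA hA' hdA
    fun n a b => coeff_eulerLagrange hweak n a b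
  set B : Fin d → UnitAddTorus (Fin d) → Matrix (Fin m) (Fin m) ℂ :=
    fun j t => (Ut t)ᴴ * (D j t + A j t * Ut t) with hB
  have hB2 (j) : EntryLp 2 (B j) := hUt.conjTranspose.top_mul ((hD j).add ((hA j).top_mul hU2))
  have hAd (j) (a b : Fin m) : ExpDecay fun n => mFourierCoeff (fun t => A j t a b) n :=
    (hper j a b).expDecay (han j a b)
  have hBd (j) (a b : Fin m) : ExpDecay fun n => mFourierCoeff (fun t => B j t a b) n := by
    rcases hdm with rfl | rfl
    · have hinj : Function.Injective (θ j) := by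
        intro n n' h
        simp only [hθdef, symbol_single] at h
        have h' : freq γ n j = freq γ n' j := by
          exact_mod_cast mul_left_cancel₀ Complex.I_ne_zero h
        refine freq_injective γ ?_
        ext i
        rw [Subsingleton.elim i j, h']
      -- For diagonal `G` the commutator acts on the entry `(a, b)` as multiplication by `g_a -
      -- g_b`, so the divergence identity is an eigenvalue equation for the symbol.
      refine expDecay_of_symbol_mul_eq hinj (z := s * (g j a - g j b)) fun n => ?_
      have h := hdiv n a b
      rw [Fin.sum_univ_one, Fin.sum_univ_one] at h
      rw [Subsingleton.elim j 0]
      exact h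
    · obtain rfl : a = 0 := Subsingleton.elim _ _
      obtain rfl : b = 0 := Subsingleton.elim _ _
      have hX2 (j) : EntryLp 2 fun t => (Ut t)ᴴ * D j t := hUt.conjTranspose.top_mul (hD j)
      -- In rank one `U* A U = A`, so `B` is the logarithmic derivative of `U` plus the analytic
      -- connection.
      have hBX (j) (n) : mFourierCoeff (fun t => B j t 0 0) n =
          mFourierCoeff (fun t => ((Ut t)ᴴ * D j t) 0 0) n +
            mFourierCoeff (fun t => A j t 0 0) n := by
        rw [← coeff_add (MemLp.integrable_two (hX2 j 0 0))
          (MemLp.integrable_two ((hA j).mono le_top 0 0))]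
        refine coeff_congr_ae ?_ n
        filter_upwards [hUu] with t ht
        have h1 := congrFun (congrFun (Matrix.mem_unitaryGroup_iff'.mp ht) 0) 0
        rw [Matrix.star_eq_conjTranspose, Matrix.mul_apply, Fin.sum_univ_one,
          Matrix.one_apply_eq] at h1
        simp only [hB, Matrix.mul_add, Matrix.add_apply, Matrix.mul_apply, Fin.sum_univ_one]
        linear_combination A j t 0 0 * h1
      have hx := expDecay_of_curl_div (τ := fun j n => freq γ n j)
        (x := fun j n => mFourierCoeff (fun t => ((Ut t)ᴴ * D j t) 0 0) n)
        (α := fun j n => mFourierCoeff (fun t => A j t 0 0) n)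
        (fun n hn => by
          by_contra! hall
          refine hn (freq_injective γ ?_)
          ext i
          rw [hall i]
          simp [freq])
        (fun j => hAd j 0 0)
        (fun i j n => by
          have h := coeff_curl_rank_one (hθ i) (hθ j) hUu hU2 (hD i) (hD j) (hd i) (hd j) n
          simp only [hθdef, symbol_single, mul_assoc] at h
          exact mul_left_cancel₀ Complex.I_ne_zero h)
        (fun n => by
          have h := hdiv n 0 0
          simp only [sub_self, mul_zero, zero_mul, Finset.sum_const_zero] at h
          refine mul_left_cancel₀ Complex.I_ne_zero ?_
          rw [mul_zero, ← h, Finset.mul_sum]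
          refine Finset.sum_congr rfl fun j _ => ?_
          rw [← hBX, ← mul_assoc, hθdef]
          simp only [symbol_single]
          rfl) j
      refine (hx.add (hAd j 0 0)).of_norm_le (K := 1) fun n => ?_
      rw [hBX, one_mul]
  obtain ⟨K, hK0, hK⟩ := exists_norm_le_symbol γ
  refine expDecay_of_deriv hK0 hK hUu hU2 hd (fun j => (hA j).mono le_top) hB2 hAd hBd
    (fun j => ?_) a b
  filter_upwards [hUu] with t ht
  have h1 : Ut t * (Ut t)ᴴ = 1 := Matrix.mem_unitaryGroup_iff.mp ht
  rw [hB, ← Matrix.mul_assoc, h1, Matrix.one_mul, add_sub_cancel_right]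

end Regularity

end

end BlochGauge

theorem mainTheorem6 (d m : ℕ) (hdm : (d = 1 ∧ 1 ≤ m) ∨ (1 ≤ d ∧ m = 1))
    (γ : Module.Basis (Fin d) ℝ (BlochGauge.Space d))
    (P : BlochGauge.Space d → BlochGauge.Fiber γ →L[ℂ] BlochGauge.Fiber γ)
    (hP : BlochGauge.IsProjectorFamily γ m P)
    (χ : Fin m → BlochGauge.Space d → BlochGauge.Fiber γ)
    (hχ : BlochGauge.IsBlochFrame γ P χ)
    (hχ_analytic : ∀ a, AnalyticOnNhd ℝ (χ a) Set.univ)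
    (s : ℝ) (hs : s = 1 ∨ s = -1)
    (U : BlochGauge.Space d → Matrix (Fin m) (Fin m) ℂ)
    (hU : BlochGauge.MemW12Unitary γ U)
    (hEL : BlochGauge.IsWeakSolution γ s (BlochGauge.berry χ) U) :
    BlochGauge.IsRealAnalytic γ U :=
  BlochGauge.isRealAnalytic_of_expDecay hU
    (BlochGauge.expDecay_of_isWeakSolution (hdm.imp And.left And.right) hχ hχ_analytic hU hEL)
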